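/- Let $F$ be a non-archimedean local field, let $G\subseteq \mathrm{GL}_n$ be a reductive linear algebraic group over $F$, and let $P=MN$ be a parabolic subgroup of $G$ defined over $F$, with a Levi decomposition over $F$ ($N$ the unipotent radical, $M$ a Levi component). Write $G,P,M,N$ also for the groups of $F$-points. Fix two-sided Haar measures on $G$ and on $M$ (reductive groups over $F$ are unimodular) and a right Haar measure on $N$. For a locally compact totally disconnected space $X$, let $\mathcal H(X)$ be the space of locally constant compactly supported functions $X\to\mathbb C$; in particular $\mathcal H(G)$ and $\mathcal H(M)$ are the Hecke algebras. Let $\delta_P$ be the modular character of $P$, defined by $\int_P f(p^{-1}x)\,dx=\delta_P(p)\int_P f(x)\,dx$ for $f\in\mathcal H(P)$, where $dx$ is a right Haar measure on $P$. The group $M$ acts on $N\backslash G$ from the left by $m\cdot Ng=Nmg$ and $G$ acts from the right. This makes $\mathcal H(N\backslash G)$ an $\mathcal H(M)$-$\mathcal H(G)$-bimodule by $$(\varphi\psi)(x)=\int_M\varphi(m)\psi(m^{-1}x)\,dm,\qquad (\psi f)(x)=\int_G\psi(xh^{-1})f(h)\,dh .$$ A smooth representation $(\pi,V)$ of $G$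 (on a complex vector space) is a left $\mathcal H(G)$-module by $\pi(f)v=\int_G f(g)\pi(g)v\,dg$. Let $\mathcal H(N\backslash G)\otimes_{\mathcal H(G)}V$ be the quotient of $\mathcal H(N\backslash G)\otimes_{\mathbb C}V$ by the span of all $\psi f\otimes v-\psi\otimes\pi(f)v$, and let $M$ act on it by $m(\psi\otimes v)=(m\psi)\otimes v$, where $(m\psi)(x)=\psi(m^{-1}x)$. Let $V(N)$ be the span of the vectors $v-\pi(u)v$ ($v\in V$, $u\in N$) and let $J_N(\pi)=V/V(N)$ be the Jacquet module, with its action of $M$ through $\pi$. **Theorem.** 1. Integration over $N$, $\mathcal P(f)(Ng)=\int_N f(ug)\,du$, is a surjection $\mathcal P:\mathcal H(G)\to\mathcal H(N\backslash G)$. 2. For every smooth representation $(\pi,V)$ of $G$, the above action of $M$ on $\mathcal H(N\backslash G)\otimes_{\mathcal H(G)}V$ is smooth, and it is the one corresponding to the left $\mathcal H(M)$-module structure $\varphi(\psi\otimes v)=(\varphi\psi)\otimes v$. 3. For every smooth representation $(\pi,V)$ of $G$ there is an isomorphism of representations of $M$, natural in $(\pi,V)$, $$\delta_P\otimes\bigl(\mathcal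 H(N\backslash G)\otimes_{\mathcal H(G)}V\bigr)\;\cong\;J_N(\pi),$$ which sends $\mathcal P(f)\otimes v$ to $\pi(f)v+V(N)$ for all $f\in\mathcal H(G)$ and $v\in V$. -/

import Mathlib

open MeasureTheory Topology
open scoped TensorProduct NNReal

universe u v

noncomputable section

namespace PadicRep

/-! ## Linear algebraic groups over a field, in the classical language

A linear algebraic `F`-group is a Zariski closed subgroup of `GL_n` over the algebraic closure of
`F` which is defined over `F`. -/

section Algebraic

variable {F : Type*} [Field F] {n : ℕ}

/-- The common zeros in `GL_n(K)` of a set of polynomials in the matrix entries. -/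
def zeroLocus {K : Type*} [Field K] (S : Set (MvPolynomial (Fin n × Fin n) K)) :
    Set (GL (Fin n) K) :=
  {g | ∀ p ∈ S, MvPolynomial.eval (fun ij => g.val ij.1 ij.2) p = 0}

/-- The ideal of the polynomials in the matrix entries that vanish on a subset of `GL_n(K)`. -/
def vanishing {K : Type*} [Field K] (H : Set (GL (Fin n) K)) :
    Ideal (MvPolynomial (Fin n × Fin n) K) where
  carrier := {p | ∀ g ∈ H, MvPolynomial.eval (fun ij => g.val ij.1 ij.2) p = 0}
  add_mem' := fun hp hq g hg => by rw [map_add, hp g hg, hq g hg, add_zero]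
  zero_mem' := fun g _ => map_zero _
  smul_mem' := fun c p hp g hg => by rw [smul_eq_mul, map_mul, hp g hg, mul_zero]

/-- Zariski closed subgroups of `GL_n(K)`. -/
def IsZariskiClosed {K : Type*} [Field K] (H : Subgroup (GL (Fin n) K)) : Prop :=
  ∃ S, (H : Set (GL (Fin n) K)) = zeroLocus S

/-- Connectedness in the Zariski topology: `H` is not the disjoint union of two nonempty
relatively closed subsets. -/
def IsZariskiConnected {K : Type*} [Field K] (H : Subgroup (GL (Fin n) K)) : Prop :=
  ∀ S T : Set (MvPolynomial (Fin n × Fin n) K),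
    (H : Set (GL (Fin n) K)) ⊆ zeroLocus S ∪ zeroLocus T →
    (H : Set (GL (Fin n) K)) ∩ (zeroLocus S ∩ zeroLocus T) = ∅ →
    (H : Set (GL (Fin n) K)) ⊆ zeroLocus S ∨ (H : Set (GL (Fin n) K)) ⊆ zeroLocus T

/-- Every element of `H` is a unipotent matrix. -/
def IsUnipotentSubgroup {K : Type*} [Field K] (H : Subgroup (GL (Fin n) K)) : Prop :=
  ∀ g ∈ H, IsNilpotent (g.val - 1)

/-- `U` is a closed connected unipotent normal subgroup of `H`. -/
structure IsConnUnipotentNormal {K : Type*} [Field K] (U H : Subgroup (GL (Fin n) K)) : Prop where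
  le : U ≤ H
  closed : IsZariskiClosed U
  connected : IsZariskiConnected U
  unipotent : IsUnipotentSubgroup U
  normal : ∀ h ∈ H, ∀ u ∈ U, h * u * h⁻¹ ∈ U

/-- `U` is the unipotent radical of `H`: its largest closed connected unipotent normal subgroup. -/
def IsUnipotentRadical {K : Type*} [Field K] (U H : Subgroup (GL (Fin n) K)) : Prop :=
  IsConnUnipotentNormal U H ∧ ∀ U', IsConnUnipotentNormal U' H → U' ≤ U

/-- `B` is a closed connected solvable subgroup of `H`. -/
structure IsConnSolvable {K : Type*} [Field K] (B H : Subgroup (GL (Fin n) K)) : Prop where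
  le : B ≤ H
  closed : IsZariskiClosed B
  connected : IsZariskiConnected B
  solvable : Group.IsSolvable B

/-- Borel subgroups: the maximal closed connected solvable subgroups. -/
def IsBorel {K : Type*} [Field K] (B H : Subgroup (GL (Fin n) K)) : Prop :=
  IsConnSolvable B H ∧ ∀ B', IsConnSolvable B' H → B ≤ B' → B' = B

variable (F n) in
/-- A linear algebraic `F`-group: a Zariski closed subgroup of `GL_n` over the algebraic closure
whose vanishing ideal is generated by polynomials with coefficients in `F`. -/
structure LinAlgGroup where
  carrier : Subgroup (GL (Fin n) (AlgebraicClosure F))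
  closed : IsZariskiClosed carrier
  definedOver : vanishing (carrier : Set (GL (Fin n) (AlgebraicClosure F))) =
    ((vanishing (carrier : Set (GL (Fin n) (AlgebraicClosure F)))).comap
      (MvPolynomial.map (algebraMap F (AlgebraicClosure F)))).map
        (MvPolynomial.map (algebraMap F (AlgebraicClosure F)))

/-- The group of `F`-rational points, a subgroup of `GL_n(F)`. -/
def LinAlgGroup.points (G : LinAlgGroup F n) : Subgroup (GL (Fin n) F) :=
  G.carrier.comap (Matrix.GeneralLinearGroup.map (algebraMap F (AlgebraicClosure F)))

/-- `G` is reductive: its unipotent radical (over the algebraic closure) is trivial. -/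
def LinAlgGroup.IsReductive (G : LinAlgGroup F n) : Prop :=
  ∀ U, IsConnUnipotentNormal U G.carrier → U = ⊥

/-- `P` is a parabolic `F`-subgroup of `G`: it contains a Borel subgroup of `G`. -/
def LinAlgGroup.IsParabolic (P G : LinAlgGroup F n) : Prop :=
  P.carrier ≤ G.carrier ∧ ∃ B, IsBorel B G.carrier ∧ B ≤ P.carrier

/-- `P = M N` is a Levi decomposition over `F`: `N` is the unipotent radical of `P`, and `P` is the
semidirect product of the `F`-groups `M` and `N`. The last field says that the projection
`P → M` is a regular map over `F`, i.e. that `M × N → P` is an isomorphism of varieties, not only a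
bijection; regular functions on `P` are polynomials in the entries divided by powers of `det`. -/
structure LinAlgGroup.IsLevi (P M N : LinAlgGroup F n) : Prop where
  radical : IsUnipotentRadical N.carrier P.carrier
  le : M.carrier ≤ P.carrier
  inf : M.carrier ⊓ N.carrier = ⊥
  prod : ∀ p ∈ P.carrier, ∃ m ∈ M.carrier, ∃ u ∈ N.carrier, p = m * u
  proj : ∃ (q : Fin n → Fin n → MvPolynomial (Fin n × Fin n) F) (k : ℕ),
    ∀ m ∈ M.carrier, ∀ u ∈ N.carrier, ∀ i j,
      MvPolynomial.aeval (fun ab : Fin n × Fin n => (m * u).val ab.1 ab.2) (q i j) =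
        (m * u).val.det ^ k * m.val i j

/-- `H(F)` viewed inside `G(F)`. -/
abbrev LinAlgGroup.pointsIn (H G : LinAlgGroup F n) : Subgroup G.points :=
  H.points.subgroupOf G.points

theorem LinAlgGroup.IsLevi.pointsIn_le {G P M N : LinAlgGroup F n} (h : P.IsLevi M N) :
    M.pointsIn G ≤ P.pointsIn G :=
  fun _ hm => h.le hm

theorem LinAlgGroup.IsLevi.pointsIn_normalizes {G P M N : LinAlgGroup F n} (h : P.IsLevi M N) :
    M.pointsIn G ≤ Subgroup.normalizer (N.pointsIn G : Set G.points) := by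
  have key : ∀ m ∈ M.pointsIn G, ∀ u ∈ N.pointsIn G, m * u * m⁻¹ ∈ N.pointsIn G := by
    intro m hm u hu
    rw [Subgroup.mem_subgroupOf, LinAlgGroup.points, Subgroup.mem_comap]
    simp only [Subgroup.coe_mul, Subgroup.coe_inv, map_mul, map_inv]
    exact h.radical.1.normal _ (h.le hm) _ hu
  intro m hm u
  refine ⟨key m hm u, fun hu => ?_⟩
  simpa [mul_assoc] using key m⁻¹ (inv_mem hm) _ hu

variable [ValuativeRel F] [TopologicalSpace F] [IsNonarchimedeanLocalField F]

variable (F) in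
theorem t2Space_of_localField : T2Space F := by
  let := IsTopologicalAddGroup.rightUniformSpace F
  have := isUniformAddGroup_of_addCommGroup (G := F)
  infer_instance

instance : LocallyCompactSpace (GL (Fin n) F) := by
  have := t2Space_of_localField F
  have : LocallyCompactSpace (Matrix (Fin n) (Fin n) F) :=
    inferInstanceAs (LocallyCompactSpace (Fin n → Fin n → F))
  have : T1Space (Matrix (Fin n) (Fin n) F) := inferInstanceAs (T1Space (Fin n → Fin n → F))
  infer_instance

theorem LinAlgGroup.isClosed_points (G : LinAlgGroup F n) :
    IsClosed (G.points : Set (GL (Fin n) F)) := by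
  have := t2Space_of_localField F
  set ι := algebraMap F (AlgebraicClosure F)
  set I := vanishing (G.carrier : Set (GL (Fin n) (AlgebraicClosure F))) with hI
  have hmem : ∀ g : GL (Fin n) (AlgebraicClosure F), g ∈ G.carrier ↔
      ∀ p ∈ I, MvPolynomial.eval (fun ij => g.val ij.1 ij.2) p = 0 := by
    intro g
    refine ⟨fun hg p hp => hp g hg, fun h => ?_⟩
    obtain ⟨S, hS⟩ := G.closed
    rw [← SetLike.mem_coe, hS]
    intro p hp
    refine h p fun g' hg' => ?_
    rw [hS] at hg'
    exact hg' p hp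
  have heval : ∀ (g : GL (Fin n) F) (p : MvPolynomial (Fin n × Fin n) F),
      MvPolynomial.eval (fun ij : Fin n × Fin n =>
        (Matrix.GeneralLinearGroup.map ι g).val ij.1 ij.2) (MvPolynomial.map ι p) =
      ι (MvPolynomial.eval (fun ij => g.val ij.1 ij.2) p) := by
    intro g p
    rw [MvPolynomial.eval_map]
    exact (MvPolynomial.eval₂_comp ι (fun ij : Fin n × Fin n => g.val ij.1 ij.2) p).symm
  have hset : (G.points : Set (GL (Fin n) F)) =
      ⋂ p ∈ I.comap (MvPolynomial.map ι),
        {g | MvPolynomial.eval (fun ij => g.val ij.1 ij.2) p = 0} := by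
    ext g
    simp only [Set.mem_iInter, Set.mem_ofPred_eq, SetLike.mem_coe, LinAlgGroup.points,
      Subgroup.mem_comap]
    rw [hmem]
    constructor
    · intro h p hp
      have := h _ hp
      rw [heval] at this
      exact (map_eq_zero ι).1 this
    · intro h p hp
      have hle : I ≤ RingHom.ker (MvPolynomial.eval (fun ij : Fin n × Fin n =>
          (Matrix.GeneralLinearGroup.map ι g).val ij.1 ij.2)) := by
        rw [hI, G.definedOver, Ideal.map_le_iff_le_comap]
        intro q hq
        rw [Ideal.mem_comap, RingHom.mem_ker, heval, h q hq, map_zero]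
      exact hle hp
  rw [hset]
  refine isClosed_biInter fun p _ => isClosed_eq ?_ continuous_const
  have hent : Continuous fun (g : GL (Fin n) F) (ij : Fin n × Fin n) => g.val ij.1 ij.2 :=
    continuous_pi fun ij => Units.continuous_val.matrix_elem ij.1 ij.2
  exact (MvPolynomial.continuous_eval p).comp hent

instance (G : LinAlgGroup F n) : LocallyCompactSpace G.points :=
  G.isClosed_points.isClosedEmbedding_subtypeVal.locallyCompactSpace

instance (P G : LinAlgGroup F n) : LocallyCompactSpace (P.pointsIn G) := by
  have : IsClosed (P.pointsIn G : Set G.points) :=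
    P.isClosed_points.preimage continuous_subtype_val
  exact this.isClosedEmbedding_subtypeVal.locallyCompactSpace

end Algebraic

/-! ## Locally constant compactly supported functions -/

section TestFn

/-- The locally constant compactly supported functions `X → ℂ`, as a subspace of all functions. -/
def testFnSubmodule (X : Type*) [TopologicalSpace X] : Submodule ℂ (X → ℂ) where
  carrier := {f | IsLocallyConstant f ∧ HasCompactSupport f}
  add_mem' := fun hf hg => ⟨hf.1.add hg.1, hf.2.add hg.2⟩
  zero_mem' := ⟨IsLocallyConstant.const 0, HasCompactSupport.zero⟩
  smul_mem' := fun c _ hf => ⟨hf.1.comp (fun z => c • z), hf.2.smul_left (f := fun _ => c)⟩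

/-- `ℋ(X)`: the space of locally constant compactly supported functions `X → ℂ`. -/
def TestFn (X : Type*) [TopologicalSpace X] : Type _ := testFnSubmodule X

instance (X : Type*) [TopologicalSpace X] : AddCommGroup (TestFn X) :=
  inferInstanceAs (AddCommGroup (testFnSubmodule X))

instance (X : Type*) [TopologicalSpace X] : Module ℂ (TestFn X) :=
  inferInstanceAs (Module ℂ (testFnSubmodule X))

@[ext]
theorem TestFn.ext {X : Type*} [TopologicalSpace X] {f g : TestFn X} (h : ∀ x, f.1 x = g.1 x) :
    f = g :=
  Subtype.ext (funext h)

theorem TestFn.mem_of {X : Type*} [TopologicalSpace X] {f : X → ℂ}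
    (h : ∀ x, ∀ᶠ y in 𝓝 x, f y = f x) {C : Set X} (hC : IsCompact C)
    (hf : ∀ x, f x ≠ 0 → x ∈ C) : f ∈ testFnSubmodule X := by
  have hl : IsLocallyConstant f := (IsLocallyConstant.iff_eventually_eq f).2 h
  have hcl : IsClosed (Function.support f) := by
    have : Function.support f = f ⁻¹' {0}ᶜ := by ext; simp
    have h0 : IsOpen (f ⁻¹' {0}) := hl {0}
    rw [this, Set.preimage_compl]
    exact h0.isClosed_compl
  refine ⟨hl, ?_⟩
  rw [HasCompactSupport, tsupport, hcl.closure_eq]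
  exact hC.of_isClosed_subset hcl hf

/-- If `S` and `R` are jointly continuous and each `R a` is a left inverse of `S a`, then
`x ↦ ∫ φ(a) ψ(S a x) da` is again in `ℋ(X)`. -/
theorem TestFn.integral_mem {A X : Type*} [TopologicalSpace A] [TopologicalSpace X]
    [MeasurableSpace A] (μ : Measure A) (S R : A → X → X)
    (hS : Continuous fun p : A × X => S p.1 p.2) (hR : Continuous fun p : A × X => R p.1 p.2)
    (hRS : ∀ a x, R a (S a x) = x) (φ : TestFn A) (ψ : TestFn X) :
    (fun x => ∫ a, φ.1 a * ψ.1 (S a x) ∂μ) ∈ testFnSubmodule X := by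
  have hφ := φ.2
  have hψ := ψ.2
  refine TestFn.mem_of (fun x => ?_)
    ((hφ.2.prod hψ.2).image hR) (fun x hx => ?_)
  · have key : ∀ᶠ y in 𝓝 x, ∀ a ∈ tsupport φ.1, ψ.1 (S a y) = ψ.1 (S a x) := by
      refine hφ.2.eventually_forall_of_forall_eventually fun a _ => ?_
      have h1 : IsLocallyConstant fun p : X × A => ψ.1 (S p.2 p.1) :=
        hψ.1.comp_continuous (hS.comp continuous_swap)
      have h2 : IsLocallyConstant fun p : X × A => ψ.1 (S p.2 x) :=
        hψ.1.comp_continuous (hS.comp (continuous_snd.prodMk continuous_const))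
      filter_upwards [h1.eventually_eq (x, a), h2.eventually_eq (x, a)] with p hp hp'
      rw [hp, hp']
    filter_upwards [key] with y hy
    congr 1
    funext a
    by_cases ha : a ∈ tsupport φ.1
    · rw [hy a ha]
    · rw [image_eq_zero_of_notMem_tsupport ha, zero_mul, zero_mul]
  · obtain ⟨a, ha⟩ : ∃ a, φ.1 a * ψ.1 (S a x) ≠ 0 := by
      by_contra! h
      exact hx (by simp [h])
    exact ⟨(a, S a x), ⟨subset_tsupport _ (left_ne_zero_of_mul ha),
      subset_tsupport _ (right_ne_zero_of_mul ha)⟩, hRS a x⟩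

end TestFn

/-! ## Hecke algebras, bimodules and Jacquet modules -/

section Hecke

variable {Γ : Type*} [Group Γ]

/-- The space `N \ Γ` of cosets `N g`, with the quotient topology. -/
abbrev RightCosets (N : Subgroup Γ) : Type _ := Quotient (QuotientGroup.rightRel N)

/-- The coset `N g`. -/
abbrev RightCosets.mk (N : Subgroup Γ) (g : Γ) : RightCosets N := Quotient.mk _ g

theorem RightCosets.mk_eq {N : Subgroup Γ} {g h : Γ} :
    RightCosets.mk N g = RightCosets.mk N h ↔ h * g⁻¹ ∈ N :=
  Quotient.eq.trans QuotientGroup.rightRel_apply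

/-- `h : N g ↦ N g h`. -/
def RightCosets.mulRight (N : Subgroup Γ) (h : Γ) : RightCosets N → RightCosets N :=
  Quotient.map (fun g => g * h) fun a b hab => by
    have hab' : b * a⁻¹ ∈ N := RightCosets.mk_eq.1 (Quotient.sound hab)
    refine Quotient.exact (RightCosets.mk_eq.2 ?_)
    simpa [mul_assoc] using hab'

/-- `m : N g ↦ N m g`, for `m` in a subgroup `M` that normalizes `N`. -/
def RightCosets.mulLeft {M N : Subgroup Γ} (hMN : M ≤ Subgroup.normalizer (N : Set Γ)) (m : M) :
    RightCosets N → RightCosets N :=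
  Quotient.map (fun g => (m : Γ) * g) fun a b hab => by
    have hab' : b * a⁻¹ ∈ N := RightCosets.mk_eq.1 (Quotient.sound hab)
    refine Quotient.exact (RightCosets.mk_eq.2 ?_)
    simpa [mul_assoc] using (hMN m.2 _).1 hab'

theorem RightCosets.mulLeft_mul {M N : Subgroup Γ} (hMN : M ≤ Subgroup.normalizer (N : Set Γ))
    (a b : M) (x : RightCosets N) :
    RightCosets.mulLeft hMN a (RightCosets.mulLeft hMN b x) =
      RightCosets.mulLeft hMN (a * b) x := by
  induction x using Quotient.inductionOn with
  | h g => exact congrArg (RightCosets.mk N) (mul_assoc _ _ _).symm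

theorem RightCosets.mulLeft_one {M N : Subgroup Γ} (hMN : M ≤ Subgroup.normalizer (N : Set Γ))
    (x : RightCosets N) : RightCosets.mulLeft hMN 1 x = x := by
  induction x using Quotient.inductionOn with
  | h g => exact congrArg (RightCosets.mk N) (one_mul _)

theorem RightCosets.mulLeft_mulRight {M N : Subgroup Γ}
    (hMN : M ≤ Subgroup.normalizer (N : Set Γ)) (m : M) (h : Γ) (x : RightCosets N) :
    RightCosets.mulLeft hMN m (RightCosets.mulRight N h x) =
      RightCosets.mulRight N h (RightCosets.mulLeft hMN m x) := by
  induction x using Quotient.inductionOn with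
  | h g => exact congrArg (RightCosets.mk N) (mul_assoc _ _ _).symm

variable [TopologicalSpace Γ] [IsTopologicalGroup Γ]

theorem RightCosets.isOpenQuotientMap_mk (N : Subgroup Γ) :
    IsOpenQuotientMap (RightCosets.mk N) :=
  ⟨Quot.mk_surjective, continuous_quot_mk, isOpenMap_quotient_mk'_mul (Γ := N) (T := Γ)⟩

theorem RightCosets.continuous_mulRight (N : Subgroup Γ) :
    Continuous fun p : Γ × RightCosets N => RightCosets.mulRight N p.1 p.2 := by
  rw [← (IsOpenQuotientMap.id.prodMap (isOpenQuotientMap_mk N)).continuous_comp_iff]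
  exact (isOpenQuotientMap_mk N).continuous.comp (continuous_snd.mul continuous_fst)

theorem RightCosets.continuous_mulLeft {M N : Subgroup Γ}
    (hMN : M ≤ Subgroup.normalizer (N : Set Γ)) :
    Continuous fun p : M × RightCosets N => RightCosets.mulLeft hMN p.1 p.2 := by
  rw [← (IsOpenQuotientMap.id.prodMap (isOpenQuotientMap_mk N)).continuous_comp_iff]
  exact (isOpenQuotientMap_mk N).continuous.comp
    ((continuous_subtype_val.comp continuous_fst).mul continuous_snd)

/-- The translation representation of `M` on `ℋ(N \ Γ)`: `(m ψ)(x) = ψ(m⁻¹ x)`. -/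
def translation {M N : Subgroup Γ} (hMN : M ≤ Subgroup.normalizer (N : Set Γ)) :
    Representation ℂ M (TestFn (RightCosets N)) where
  toFun m :=
    { toFun := fun ψ => Subtype.mk (fun x => ψ.1 (RightCosets.mulLeft hMN m⁻¹ x)) <| by
        have hc : ∀ a : M, Continuous (RightCosets.mulLeft hMN a) := fun a =>
          (RightCosets.continuous_mulLeft hMN).comp (continuous_const.prodMk continuous_id)
        refine TestFn.mem_of (fun x => ?_) (ψ.2.2.image (hc m)) fun x hx => ?_
        · exact (ψ.2.1.comp_continuous (hc m⁻¹)).eventually_eq x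
        · refine ⟨_, subset_tsupport _ hx, ?_⟩
          rw [RightCosets.mulLeft_mul, mul_inv_cancel, RightCosets.mulLeft_one]
      map_add' := fun _ _ => rfl
      map_smul' := fun _ _ => rfl }
  map_one' := by
    ext ψ x
    change ψ.1 (RightCosets.mulLeft hMN 1⁻¹ x) = ψ.1 x
    rw [inv_one, RightCosets.mulLeft_one]
  map_mul' a b := by
    ext ψ x
    change ψ.1 (RightCosets.mulLeft hMN (a * b)⁻¹ x) =
      ψ.1 (RightCosets.mulLeft hMN b⁻¹ (RightCosets.mulLeft hMN a⁻¹ x))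
    rw [mul_inv_rev, RightCosets.mulLeft_mul]

/-- A locally constant compactly supported function is uniformly so under right translation. -/
theorem TestFn.exists_uniform (f : TestFn Γ) :
    ∃ U ∈ 𝓝 (1 : Γ), ∀ u ∈ U, ∀ g, f.1 (g * u) = f.1 g := by
  have key : ∀ᶠ u in 𝓝 (1 : Γ), ∀ g ∈ tsupport f.1, f.1 (g * u) = f.1 g := by
    refine f.2.2.eventually_forall_of_forall_eventually fun g _ => ?_
    have h1 : IsLocallyConstant fun p : Γ × Γ => f.1 (p.2 * p.1) :=
      f.2.1.comp_continuous (continuous_snd.mul continuous_fst)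
    have h2 : IsLocallyConstant fun p : Γ × Γ => f.1 p.2 := f.2.1.comp_continuous continuous_snd
    filter_upwards [h1.eventually_eq (1, g), h2.eventually_eq (1, g)] with p hp hp'
    rw [hp, hp', mul_one]
  have key' : ∀ᶠ u in 𝓝 (1 : Γ), ∀ g ∈ tsupport f.1, f.1 (g * u⁻¹) = f.1 g := by
    have : Filter.Tendsto (fun u : Γ => u⁻¹) (𝓝 1) (𝓝 1) := by
      simpa using (continuous_inv (G := Γ)).tendsto 1
    exact this.eventually key
  refine ⟨_, key.and key', fun u hu g => ?_⟩
  by_cases hg : f.1 g = 0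
  · by_contra hne
    have h1 : f.1 (g * u) ≠ 0 := fun h => hne (h.trans hg.symm)
    have h2 := hu.2 _ (subset_tsupport _ h1)
    rw [mul_inv_cancel_right] at h2
    exact hne h2.symm
  · exact hu.1 g (subset_tsupport _ hg)

section Bimodule

variable [MeasurableSpace Γ]

/-- The right `ℋ(Γ)`-action on `ℋ(N \ Γ)`: `(ψ f)(x) = ∫_Γ ψ(x h⁻¹) f(h) dh`. -/
def rightAct (μ : Measure Γ) (N : Subgroup Γ) (ψ : TestFn (RightCosets N)) (f : TestFn Γ) :
    TestFn (RightCosets N) :=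
  Subtype.mk (fun x => ∫ h, f.1 h * ψ.1 (RightCosets.mulRight N h⁻¹ x) ∂μ) <|
    TestFn.integral_mem μ (fun h => RightCosets.mulRight N h⁻¹) (RightCosets.mulRight N)
      ((RightCosets.continuous_mulRight N).comp (continuous_fst.inv.prodMk continuous_snd))
      (RightCosets.continuous_mulRight N)
      (fun h x => by
        induction x using Quotient.inductionOn with
        | h g => exact congrArg (RightCosets.mk N) (inv_mul_cancel_right g h)) f ψ

/-- The left `ℋ(M)`-action on `ℋ(N \ Γ)`: `(φ ψ)(x) = ∫_M φ(m) ψ(m⁻¹ x) dm`. -/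
def leftAct {M N : Subgroup Γ} (hMN : M ≤ Subgroup.normalizer (N : Set Γ)) (μM : Measure M)
    (φ : TestFn M) (ψ : TestFn (RightCosets N)) : TestFn (RightCosets N) :=
  Subtype.mk (fun x => ∫ m, φ.1 m * ψ.1 (RightCosets.mulLeft hMN m⁻¹ x) ∂μM) <|
    TestFn.integral_mem μM (fun m => RightCosets.mulLeft hMN m⁻¹) (RightCosets.mulLeft hMN)
      ((RightCosets.continuous_mulLeft hMN).comp (continuous_fst.inv.prodMk continuous_snd))
      (RightCosets.continuous_mulLeft hMN)
      (fun m x => by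
        rw [RightCosets.mulLeft_mul, mul_inv_cancel, RightCosets.mulLeft_one]) φ ψ

/-- Integration over `N`: the map `ℋ(Γ) → ℋ(N \ Γ)`, `𝒫(f)(N g) = ∫_N f(u g) du`, for a
right-invariant measure `du` on `N`. -/
def integrateN [BorelSpace Γ] (N : Subgroup Γ) (μN : Measure N) [μN.IsMulRightInvariant]
    (f : TestFn Γ) : TestFn (RightCosets N) :=
  Subtype.mk (Quotient.lift (fun g => ∫ u : N, f.1 (u * g) ∂μN) fun a b hab => by
      have hab : b * a⁻¹ ∈ N := RightCosets.mk_eq.1 (Quotient.sound hab)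
      have := integral_mul_right_eq_self (μ := μN) (fun u : N => f.1 (u * a)) ⟨b * a⁻¹, hab⟩
      simpa [mul_assoc] using this.symm) <| by
    have hq := RightCosets.isOpenQuotientMap_mk N
    refine TestFn.mem_of (fun x => ?_) (f.2.2.image hq.continuous) fun x hx => ?_
    · obtain ⟨g, rfl⟩ := hq.surjective x
      obtain ⟨U, hU, h⟩ := f.exists_uniform
      have hU' : (fun u => g * u) '' U ∈ 𝓝 g := by
        have := (Homeomorph.mulLeft g).isOpenMap.image_mem_nhds hU
        simpa using this
      refine Filter.mem_of_superset (hq.isOpenMap.image_mem_nhds hU') ?_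
      rintro _ ⟨_, ⟨u, hu, rfl⟩, rfl⟩
      change (∫ v : N, f.1 (v * (g * u)) ∂μN) = ∫ v : N, f.1 (v * g) ∂μN
      simp only [← mul_assoc, h u hu]
    · obtain ⟨g, rfl⟩ := hq.surjective x
      change (∫ u : N, f.1 (u * g) ∂μN) ≠ 0 at hx
      obtain ⟨u, hu⟩ : ∃ u : N, f.1 (u * g) ≠ 0 := by
        by_contra! h'
        exact hx (by simp [h'])
      refine ⟨u * g, subset_tsupport _ hu, ?_⟩
      rw [RightCosets.mk_eq]
      simp

end Bimodule

/-- Smooth representations: every vector is fixed by an open subgroup. -/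
def IsSmooth {A : Type*} [Group A] [TopologicalSpace A] {V : Type*} [AddCommGroup V] [Module ℂ V]
    (π : Representation ℂ A V) : Prop :=
  ∀ v, ∃ K : Subgroup A, IsOpen (K : Set A) ∧ ∀ k ∈ K, π k v = v

/-- The integral of a locally constant compactly supported function `Φ` with values in a complex
vector space, as the finite sum of the values weighted by the measures of the fibres. -/
def lcIntegral {A : Type*} [MeasurableSpace A] (μ : Measure A) {V : Type*} [AddCommGroup V]
    [Module ℂ V] (Φ : A → V) : V :=
  ∑ᶠ v : V, (μ.real (Φ ⁻¹' {v}) : ℂ) • v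

/-- `π(f) v = ∫ f(g) π(g) v dg`, which makes a smooth representation a module over the Hecke
algebra. -/
def heckeAct {A : Type*} [Group A] [TopologicalSpace A] [MeasurableSpace A] (μ : Measure A)
    {V : Type*} [AddCommGroup V] [Module ℂ V] (π : Representation ℂ A V) (f : TestFn A) (v : V) :
    V :=
  lcIntegral μ fun g => f.1 g • π g v

section Tensor

variable [MeasurableSpace Γ] {V : Type*} [AddCommGroup V] [Module ℂ V]

/-- The relations `ψ f ⊗ v = ψ ⊗ π(f) v`. -/
def heckeRelations (μ : Measure Γ) (N : Subgroup Γ) (π : Representation ℂ Γ V) :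
    Submodule ℂ (TestFn (RightCosets N) ⊗[ℂ] V) :=
  Submodule.span ℂ {t | ∃ (ψ : TestFn (RightCosets N)) (f : TestFn Γ) (v : V),
    t = rightAct μ N ψ f ⊗ₜ[ℂ] v - ψ ⊗ₜ[ℂ] heckeAct μ π f v}

/-- `ℋ(N \ Γ) ⊗_{ℋ(Γ)} V`. -/
abbrev HeckeTensor (μ : Measure Γ) (N : Subgroup Γ) (π : Representation ℂ Γ V) : Type _ :=
  (TestFn (RightCosets N) ⊗[ℂ] V) ⧸ heckeRelations μ N π

/-- The class of `ψ ⊗ v`. -/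
def HeckeTensor.mk (μ : Measure Γ) (N : Subgroup Γ) (π : Representation ℂ Γ V)
    (ψ : TestFn (RightCosets N)) (v : V) : HeckeTensor μ N π :=
  (heckeRelations μ N π).mkQ (ψ ⊗ₜ[ℂ] v)

theorem translation_rightAct {M N : Subgroup Γ} (hMN : M ≤ Subgroup.normalizer (N : Set Γ))
    (μ : Measure Γ) (m : M) (ψ : TestFn (RightCosets N)) (f : TestFn Γ) :
    translation hMN m (rightAct μ N ψ f) = rightAct μ N (translation hMN m ψ) f := by
  ext x
  change (∫ h, f.1 h * ψ.1 (RightCosets.mulRight N h⁻¹ (RightCosets.mulLeft hMN m⁻¹ x)) ∂μ) =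
    ∫ h, f.1 h * ψ.1 (RightCosets.mulLeft hMN m⁻¹ (RightCosets.mulRight N h⁻¹ x)) ∂μ
  simp only [RightCosets.mulLeft_mulRight]

/-- The representation of `M` on `ℋ(N \ Γ) ⊗_{ℋ(Γ)} V`: `m (ψ ⊗ v) = (m ψ) ⊗ v`. -/
def tensorRep {M N : Subgroup Γ} (hMN : M ≤ Subgroup.normalizer (N : Set Γ)) (μ : Measure Γ)
    (π : Representation ℂ Γ V) : Representation ℂ M (HeckeTensor μ N π) where
  toFun m := Submodule.mapQ _ _ ((translation hMN m).rTensor V) <| by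
    rw [heckeRelations, Submodule.span_le]
    rintro _ ⟨ψ, f, v, rfl⟩
    refine Submodule.subset_span ⟨translation hMN m ψ, f, v, ?_⟩
    simp [translation_rightAct]
  map_one' := by
    ext ψ v
    simp
  map_mul' a b := by
    ext ψ v
    simp

end Tensor

section Jacquet

variable {V : Type*} [AddCommGroup V] [Module ℂ V]

/-- `V(N)`, the span of the vectors `v - π(u) v` with `u ∈ N`. -/
def jacquetKer (N : Subgroup Γ) (π : Representation ℂ Γ V) : Submodule ℂ V :=
  Submodule.span ℂ {w | ∃ (v : V) (u : Γ), u ∈ N ∧ w = v - π u v}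

/-- The Jacquet module `J_N(π) = V / V(N)`. -/
abbrev Jacquet (N : Subgroup Γ) (π : Representation ℂ Γ V) : Type _ := V ⧸ jacquetKer N π

/-- The representation of `M` on the Jacquet module: `m (v + V(N)) = π(m) v + V(N)`. -/
def jacquetRep {M N : Subgroup Γ} (hMN : M ≤ Subgroup.normalizer (N : Set Γ))
    (π : Representation ℂ Γ V) : Representation ℂ M (Jacquet N π) where
  toFun m := Submodule.mapQ _ _ (π m) <| by
    rw [jacquetKer, Submodule.span_le]
    rintro _ ⟨v, u, hu, rfl⟩
    refine Submodule.subset_span ⟨π m v, m * u * (m : Γ)⁻¹, (hMN m.2 u).1 hu, ?_⟩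
    simp [← Module.End.mul_apply, ← map_mul, mul_assoc]
  map_one' := by
    ext v
    simp
  map_mul' a b := by
    ext v
    simp

/-- The map of Jacquet modules induced by a `Γ`-equivariant map. -/
def jacquetMap (N : Subgroup Γ) {V' : Type*} [AddCommGroup V'] [Module ℂ V']
    (π : Representation ℂ Γ V) (π' : Representation ℂ Γ V') (A : V →ₗ[ℂ] V')
    (hA : ∀ g v, A (π g v) = π' g (A v)) : Jacquet N π →ₗ[ℂ] Jacquet N π' :=
  Submodule.mapQ _ _ A <| by
    rw [jacquetKer, Submodule.span_le]
    rintro _ ⟨v, u, hu, rfl⟩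
    exact Submodule.subset_span ⟨A v, u, hu, by rw [map_sub, hA]⟩

end Jacquet

/-- The twist `χ ⊗ ρ` of a representation by a character. -/
def twist {A : Type*} [Group A] (χ : A →* ℂ) {W : Type*} [AddCommGroup W] [Module ℂ W]
    (ρ : Representation ℂ A W) : Representation ℂ A W where
  toFun a := χ a • ρ a
  map_one' := by simp
  map_mul' a b := by
    ext w
    simp only [map_mul, LinearMap.smul_apply, Module.End.mul_apply, map_smul, mul_smul]
    rw [smul_comm]

/-- The modular character `δ_P` of `P`, normalized by `∫_P f(g⁻¹ x) dx = δ_P(g) ∫_P f(x) dx` for a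
right Haar measure `dx`; equivalently `∫_P f(x g) dx = δ_P(g) ∫_P f(x) dx` for a left Haar measure,
which is the convention of `Measure.modularCharacter`. -/
def modulus (P : Type*) [Group P] [TopologicalSpace P] [IsTopologicalGroup P]
    [LocallyCompactSpace P] : P →* ℂ :=
  ((Complex.ofRealHom.comp NNReal.toRealHom : ℝ≥0 →+* ℂ) : ℝ≥0 →* ℂ).comp
    Measure.modularCharacter

end Hecke

end PadicRep

end

open PadicRep

noncomputable section

namespace PadicRep

set_option linter.unusedSectionVars false

/-! ## Integration of locally constant compactly supported functions -/

section Integral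

variable {A : Type*} [TopologicalSpace A]

/-! Write `𝒫` for integration over `N` and `e_K` for the indicator of a compact open subgroup `K`
divided by its volume. By Fubini `𝒫(f f') = 𝒫(f) f'`, and `π(f f') = π(f) π(f')`. Two facts then
make `𝒫(f) ⊗ v ↦ π(f) v + V(N)` a well-defined map on the tensor product over the Hecke algebra.
First, `𝒫` is onto: divide out `𝒫` of the indicator of a large compact open set
(`integrateN_surjective`). Second, a linear map on `ℋ(G)` that is invariant under left translation
by `N` vanishes on the kernel of `𝒫` (`eq_zero_of_integrateN_eq_zero`), and `f ↦ π(f) v + V(N)` is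
such a map.

The inverse sends `v` to `𝒫(e_K) ⊗ v` for any compact open `K` fixing `v`. If `f` is left
`K`-invariant, then `f = e_K f`, so `𝒫(f) ⊗ v = 𝒫(e_K) ⊗ π(f) v`. This one identity gives
independence of `K`, invariance under `N`, and that the two maps are mutually inverse.

For `m` in `M`, moving `m⁻¹` across `u` in `∫ f(u m⁻¹ g) du` conjugates `u` and gives `m 𝒫(f) = c
𝒫(m f)`, where `c` is the factor by which conjugation by `m` scales the Haar measure of `N`. It
remains to see that `δ_P(m) c = 1` (`modularCharacterFun_mul_eq_one`). Right translation by `m` of a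
product set `B C` in `P = M N` translates `B`, which is harmless since `M` is unimodular, and
conjugates `C`, which accounts for the factor.

Both the invariance argument and the modulus computation need `N` unimodular, and its elements to
have trivial modulus in `P`. The reason is that powers of a unipotent matrix stay bounded over a
non-archimedean field, so some nontrivial power is arbitrarily close to 1
(`isRecurrent_of_isNilpotent`). A modular character is trivial on compact open subgroups and has
values in the nonnegative reals, so it is trivial on such elements. -/

theorem TestFn.continuous (f : TestFn A) : Continuous f.1 := f.2.1.continuous

@[simp] theorem TestFn.add_apply (f g : TestFn A) (x : A) : (f + g).1 x = f.1 x + g.1 x := rfl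

@[simp] theorem TestFn.smul_apply (c : ℂ) (f : TestFn A) (x : A) : (c • f).1 x = c * f.1 x := rfl

/-- Evaluation at a point. -/
def TestFn.eval (x : A) : TestFn A →ₗ[ℂ] ℂ where
  toFun f := f.1 x
  map_add' _ _ := rfl
  map_smul' _ _ := rfl

theorem TestFn.sum_apply {ι : Type*} (s : Finset ι) (f : ι → TestFn A) (x : A) :
    (∑ i ∈ s, f i).1 x = ∑ i ∈ s, (f i).1 x := by
  exact map_sum (TestFn.eval x) f s

theorem finite_range_of_isLocallyConstant {V : Type*} [Zero V] {Φ : A → V}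
    (h : IsLocallyConstant Φ) (hc : HasCompactSupport Φ) : (Set.range Φ).Finite := by
  -- For the discrete topology on `V`, local constancy is continuity and compactness is finiteness.
  let : TopologicalSpace V := ⊥
  have : DiscreteTopology V := ⟨rfl⟩
  exact isCompact_iff_finite.1 (hc.isCompact_range h.continuous)

/-- The indicator function of a compact open set. -/
def TestFn.indicator [T2Space A] {C : Set A} (hC : IsCompact C) (ho : IsOpen C) : TestFn A :=
  Subtype.mk (C.indicator 1) <| by
    refine TestFn.mem_of (fun x => ?_) hC fun x hx => Set.mem_of_indicator_ne_zero hx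
    by_cases hx : x ∈ C
    · filter_upwards [ho.mem_nhds hx] with y hy
      simp [hx, hy]
    · filter_upwards [hC.isClosed.isOpen_compl.mem_nhds hx] with y hy
      rw [Set.indicator_of_notMem hx, Set.indicator_of_notMem hy]

theorem TestFn.indicator_apply [T2Space A] {C : Set A} (hC : IsCompact C) (ho : IsOpen C) (x : A) :
    (TestFn.indicator hC ho).1 x = C.indicator 1 x := rfl

variable [MeasurableSpace A] [OpensMeasurableSpace A]

theorem TestFn.integrable (μ : Measure A) [IsFiniteMeasureOnCompacts μ] (f : TestFn A) :
    Integrable f.1 μ :=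
  f.continuous.integrable_of_hasCompactSupport f.2.2

theorem TestFn.integral_indicator [T2Space A] (μ : Measure A) {C : Set A} (hC : IsCompact C)
    (ho : IsOpen C) : ∫ x, (TestFn.indicator hC ho).1 x ∂μ = μ.real C := by
  simp only [TestFn.indicator_apply]
  rw [MeasureTheory.integral_indicator ho.measurableSet]
  simp

variable {V : Type*} [AddCommGroup V] [Module ℂ V]

/-- Only finitely many values occur, so `l ∘ Φ` is a finite combination of indicators of open
fibres. This turns the algebraic integral into ordinary ones, for which Fubini and invariance are
available. -/
theorem dual_lcIntegral (μ : Measure A) [IsFiniteMeasureOnCompacts μ] {Φ : A → V}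
    (h : IsLocallyConstant Φ) (hc : HasCompactSupport Φ) (l : V →ₗ[ℂ] ℂ) :
    l (lcIntegral μ Φ) = ∫ a, l (Φ a) ∂μ := by
  classical
  have hfin := finite_range_of_isLocallyConstant h hc
  have hopen : ∀ v, IsOpen (Φ ⁻¹' {v}) := fun v => h {v}
  have h1 : lcIntegral μ Φ = ∑ v ∈ hfin.toFinset, (μ.real (Φ ⁻¹' {v}) : ℂ) • v := by
    refine finsum_eq_sum_of_support_subset _ fun v hv => ?_
    rw [Finset.mem_coe, Set.Finite.mem_toFinset]
    by_contra hv'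
    refine hv ?_
    have : Φ ⁻¹' {v} = ∅ := Set.preimage_singleton_eq_empty.2 hv'
    simp [this]
  have h2 : ∀ a, l (Φ a) = ∑ v ∈ hfin.toFinset, (Φ ⁻¹' {v}).indicator (fun _ => l v) a := by
    intro a
    rw [Finset.sum_eq_single (Φ a)]
    · simp
    · intro v _ hv
      exact Set.indicator_of_notMem (fun h' : Φ a = v => hv h'.symm) _
    · simp
  have hint : ∀ v, Integrable ((Φ ⁻¹' {v}).indicator fun _ => l v) μ := by
    intro v
    -- The fibre over 0 may have infinite measure, but it carries the value 0; every other fibre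
    -- lies in the compact support.
    by_cases hv : v = 0
    · simp [hv]
    · refine (integrable_indicator_iff (hopen v).measurableSet).2 (integrableOn_const ?_)
      refine (lt_of_le_of_lt (measure_mono fun a ha => subset_tsupport _ ?_)
        hc.measure_lt_top).ne
      rw [Function.mem_support, show Φ a = v from ha]
      exact hv
  simp only [h1, h2, map_sum, map_smul]
  rw [integral_finsetSum _ fun v _ => hint v]
  refine Finset.sum_congr rfl fun v _ => ?_
  rw [integral_indicator_const _ (hopen v).measurableSet]
  simp

/-- Linear functionals separate the points of a vector space. All identities between `V`-valued
integrals below are proved by testing against them. -/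
theorem eq_of_forall_dual {v w : V} (h : ∀ l : V →ₗ[ℂ] ℂ, l v = l w) : v = w := by
  rw [← sub_eq_zero, ← Module.forall_dual_apply_eq_zero_iff ℂ]
  intro l
  rw [map_sub, sub_eq_zero]
  exact h l

/-- `L` may merge fibres of `Φ`, so the two finite sums do not match term by term; after testing
against functionals, both sides are the same scalar integral. -/
theorem map_lcIntegral {W : Type*} [AddCommGroup W] [Module ℂ W] (μ : Measure A)
    [IsFiniteMeasureOnCompacts μ] {Φ : A → V} (h : IsLocallyConstant Φ)
    (hc : HasCompactSupport Φ) (L : V →ₗ[ℂ] W) :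
    L (lcIntegral μ Φ) = lcIntegral μ fun a => L (Φ a) := by
  refine eq_of_forall_dual fun l => ?_
  exact (dual_lcIntegral μ h hc (l ∘ₗ L)).trans
    (dual_lcIntegral μ (h.comp L) (hc.comp_left (map_zero L)) l).symm

end Integral

/-! ## The Hecke algebra and its action on smooth representations -/

section Hecke

variable {Γ : Type*} [Group Γ] [TopologicalSpace Γ] [IsTopologicalGroup Γ]
variable {V : Type*} [AddCommGroup V] [Module ℂ V]

/-- The stabilizer of a vector. -/
def fixator (π : Representation ℂ Γ V) (v : V) : Subgroup Γ where
  carrier := {g | π g v = v}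
  one_mem' := by simp
  mul_mem' {a b} ha hb := by
    have ha : π a v = v := ha
    have hb : π b v = v := hb
    change π (a * b) v = v
    rw [map_mul, Module.End.mul_apply, hb, ha]
  inv_mem' {a} ha := by
    have ha : π a v = v := ha
    change π a⁻¹ v = v
    conv_lhs => rw [← ha]
    simp

theorem mem_fixator {π : Representation ℂ Γ V} {v : V} {g : Γ} :
    g ∈ fixator π v ↔ π g v = v := Iff.rfl

theorem IsSmooth.isOpen_fixator {π : Representation ℂ Γ V} (h : IsSmooth π) (v : V) :
    IsOpen (fixator π v : Set Γ) := by
  obtain ⟨K, hK, hv⟩ := h v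
  exact Subgroup.isOpen_mono (fun k hk => hv k hk) hK

theorem isLocallyConstant_orbit {π : Representation ℂ Γ V} (h : IsSmooth π) (v : V) :
    IsLocallyConstant fun g => π g v := by
  rw [IsLocallyConstant.iff_eventually_eq]
  intro g
  have h1 : (fixator π v : Set Γ) ∈ 𝓝 (g⁻¹ * g) := by
    rw [inv_mul_cancel]
    exact (h.isOpen_fixator v).mem_nhds (one_mem _)
  have h2 : Filter.Tendsto (fun x => g⁻¹ * x) (𝓝 g) (𝓝 (g⁻¹ * g)) :=
    (continuous_const_mul g⁻¹).tendsto g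
  filter_upwards [h2 h1] with x hx
  have hx : π (g⁻¹ * x) v = v := hx
  rw [map_mul, Module.End.mul_apply] at hx
  conv_rhs => rw [← hx]
  simp

theorem isLocallyConstant_smul {A : Type*} [TopologicalSpace A] (f : TestFn A) {Φ : A → V}
    (hΦ : IsLocallyConstant Φ) : IsLocallyConstant fun a => f.1 a • Φ a :=
  (f.2.1.prodMk hΦ).comp fun p => p.1 • p.2

theorem hasCompactSupport_smul {A : Type*} [TopologicalSpace A] (f : TestFn A) (Φ : A → V) :
    HasCompactSupport fun a => f.1 a • Φ a :=
  f.2.2.smul_right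

/-- Left translation of functions on the group: `(g f)(x) = f(g⁻¹ x)`. -/
def TestFn.leftTranslate (g : Γ) : TestFn Γ →ₗ[ℂ] TestFn Γ where
  toFun f := Subtype.mk (fun x => f.1 (g⁻¹ * x))
    ⟨f.2.1.comp_continuous (continuous_const_mul g⁻¹),
      f.2.2.comp_homeomorph (Homeomorph.mulLeft g⁻¹)⟩
  map_add' _ _ := rfl
  map_smul' _ _ := rfl

@[simp] theorem TestFn.leftTranslate_apply (g : Γ) (f : TestFn Γ) (x : Γ) :
    (TestFn.leftTranslate g f).1 x = f.1 (g⁻¹ * x) := rfl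

/-- The functions `g ↦ f(g⁻¹)`. -/
def TestFn.reflect (f : TestFn Γ) : TestFn Γ :=
  Subtype.mk (fun x => f.1 x⁻¹)
    ⟨f.2.1.comp_continuous continuous_inv, f.2.2.comp_homeomorph (Homeomorph.inv Γ)⟩

/-- The elements under right translation by which `f` is invariant. -/
def TestFn.rightStab (f : TestFn Γ) : Subgroup Γ where
  carrier := {u | ∀ g, f.1 (g * u) = f.1 g}
  one_mem' := by simp
  mul_mem' {a b} ha hb g := by rw [← mul_assoc, hb, ha]
  inv_mem' {a} ha g := by rw [← ha (g * a⁻¹), inv_mul_cancel_right]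

/-- The elements under left translation by which `f` is invariant. -/
def TestFn.leftStab (f : TestFn Γ) : Subgroup Γ where
  carrier := {u | ∀ g, f.1 (u * g) = f.1 g}
  one_mem' := by simp
  mul_mem' {a b} ha hb g := by rw [mul_assoc, ha, hb]
  inv_mem' {a} ha g := by rw [← ha (a⁻¹ * g), mul_inv_cancel_left]

theorem TestFn.isOpen_rightStab (f : TestFn Γ) : IsOpen (f.rightStab : Set Γ) := by
  obtain ⟨U, hU, h⟩ := f.exists_uniform
  exact Subgroup.isOpen_of_mem_nhds _ (Filter.mem_of_superset hU h)

theorem TestFn.isOpen_leftStab (f : TestFn Γ) : IsOpen (f.leftStab : Set Γ) := by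
  refine Subgroup.isOpen_mono (H₁ := f.reflect.rightStab) (fun u hu g => ?_)
    (TestFn.isOpen_rightStab _)
  have h := inv_mem hu g⁻¹
  change f.1 (g⁻¹ * u⁻¹)⁻¹ = f.1 g⁻¹⁻¹ at h
  simpa using h

/-- Locally compact totally disconnected groups have arbitrarily small compact open subgroups. -/
theorem exists_compact_open_subgroup [T2Space Γ] [LocallyCompactSpace Γ]
    [TotallyDisconnectedSpace Γ] {U : Set Γ} (hU : U ∈ 𝓝 1) :
    ∃ K : Subgroup Γ, IsOpen (K : Set Γ) ∧ IsCompact (K : Set Γ) ∧ (K : Set Γ) ⊆ U := by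
  obtain ⟨C, hC, hC1, hCU⟩ := exists_compact_subset isOpen_interior (mem_interior_iff_mem_nhds.2 hU)
  obtain ⟨W, hW, hW1, hWC⟩ :=
    loc_compact_Haus_tot_disc_of_zero_dim.exists_subset_of_mem_open hC1 isOpen_interior
  have hWC' : W ⊆ C := hWC.trans interior_subset
  have hWc : IsCompact W := hC.of_isClosed_subset hW.1 hWC'
  -- The right stabilizer of the indicator of `W` is a subgroup, open by uniform local constancy,
  -- and lies in `W` because it moves 1 within `W`.
  set f := TestFn.indicator hWc hW.2
  have hfW : (f.rightStab : Set Γ) ⊆ W := by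
    intro u hu
    have h := hu 1
    rw [one_mul, TestFn.indicator_apply, TestFn.indicator_apply, Set.indicator_of_mem hW1] at h
    exact Set.mem_of_indicator_ne_zero (by rw [h]; exact one_ne_zero)
  refine ⟨f.rightStab, f.isOpen_rightStab, ?_, hfW.trans (hWC'.trans (hCU.trans interior_subset))⟩
  exact hWc.of_isClosed_subset (Subgroup.isClosed_of_isOpen _ f.isOpen_rightStab) hfW

variable [MeasurableSpace Γ] [BorelSpace Γ] (μ : Measure Γ) [μ.IsHaarMeasure]

theorem dual_heckeAct {A : Type*} [Group A] [TopologicalSpace A] [IsTopologicalGroup A]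
    [MeasurableSpace A] [BorelSpace A] (μ : Measure A) [IsFiniteMeasureOnCompacts μ]
    {π : Representation ℂ A V} (h : IsSmooth π) (f : TestFn A) (v : V)
    (l : V →ₗ[ℂ] ℂ) : l (heckeAct μ π f v) = ∫ g, f.1 g * l (π g v) ∂μ := by
  rw [heckeAct, dual_lcIntegral μ (isLocallyConstant_smul f (isLocallyConstant_orbit h v))
    (hasCompactSupport_smul f _)]
  simp

theorem integrable_mul_orbit (f : TestFn Γ) {φ : Γ → ℂ} (hφ : IsLocallyConstant φ) :
    Integrable (fun g => f.1 g * φ g) μ :=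
  (f.continuous.mul hφ.continuous).integrable_of_hasCompactSupport f.2.2.mul_right

/-- The action of the Hecke algebra as a bilinear map. -/
def heckeHom {π : Representation ℂ Γ V} (h : IsSmooth π) : TestFn Γ →ₗ[ℂ] V →ₗ[ℂ] V :=
  LinearMap.mk₂ ℂ (heckeAct μ π)
    (fun f f' v => eq_of_forall_dual fun l => by
      have hl := (isLocallyConstant_orbit h v).comp l
      simp only [map_add, dual_heckeAct μ h, TestFn.add_apply, add_mul]
      exact integral_add (integrable_mul_orbit μ f hl) (integrable_mul_orbit μ f' hl))
    (fun c f v => eq_of_forall_dual fun l => by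
      simp only [map_smul, dual_heckeAct μ h, TestFn.smul_apply, mul_assoc, smul_eq_mul]
      exact integral_const_mul c _)
    (fun f v w => eq_of_forall_dual fun l => by
      have hv := (isLocallyConstant_orbit h v).comp l
      have hw := (isLocallyConstant_orbit h w).comp l
      simp only [map_add, dual_heckeAct μ h, mul_add]
      exact integral_add (integrable_mul_orbit μ f hv) (integrable_mul_orbit μ f hw))
    (fun c f v => eq_of_forall_dual fun l => by
      simp only [map_smul, dual_heckeAct μ h, smul_eq_mul, mul_left_comm _ c]
      exact integral_const_mul c _)

@[simp] theorem heckeHom_apply {π : Representation ℂ Γ V} (h : IsSmooth π) (f : TestFn Γ) (v : V) :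
    heckeHom μ h f v = heckeAct μ π f v := rfl

theorem map_heckeAct {V' : Type*} [AddCommGroup V'] [Module ℂ V'] {π : Representation ℂ Γ V}
    {π' : Representation ℂ Γ V'} (h : IsSmooth π) (L : V →ₗ[ℂ] V')
    (hL : ∀ g v, L (π g v) = π' g (L v)) (f : TestFn Γ) (v : V) :
    L (heckeAct μ π f v) = heckeAct μ π' f (L v) := by
  rw [heckeAct, map_lcIntegral μ (isLocallyConstant_smul f (isLocallyConstant_orbit h v))
    (hasCompactSupport_smul f _)]
  simp only [map_smul, hL]
  rfl

theorem heckeAct_leftTranslate {π : Representation ℂ Γ V} (h : IsSmooth π) (g : Γ) (f : TestFn Γ)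
    (v : V) : heckeAct μ π (TestFn.leftTranslate g f) v = π g (heckeAct μ π f v) := by
  refine eq_of_forall_dual fun l => ?_
  rw [← LinearMap.comp_apply, dual_heckeAct μ h, dual_heckeAct μ h,
    ← integral_mul_left_eq_self _ g]
  simp

/-- The convolution product `(f f')(x) = ∫ f(x h⁻¹) f'(h) dh`. -/
def TestFn.conv (f f' : TestFn Γ) : TestFn Γ :=
  Subtype.mk (fun x => ∫ h, f'.1 h * f.1 (x * h⁻¹) ∂μ) <|
    TestFn.integral_mem μ (fun h x => x * h⁻¹) (fun h x => x * h) (by fun_prop) (by fun_prop)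
      (fun h x => inv_mul_cancel_right x h) f' f

theorem TestFn.conv_apply (f f' : TestFn Γ) (x : Γ) :
    (TestFn.conv μ f f').1 x = ∫ h, f'.1 h * f.1 (x * h⁻¹) ∂μ := rfl

theorem TestFn.hasCompactSupport_conv (f f' : TestFn Γ) :
    HasCompactSupport (fun p : Γ × Γ => f'.1 p.2 * f.1 (p.1 * p.2⁻¹)) := by
  refine HasCompactSupport.intro (K := (fun q : Γ × Γ => (q.1 * q.2, q.2)) ''
    (tsupport f.1 ×ˢ tsupport f'.1)) ?_ ?_
  · exact (f.2.2.prod f'.2.2).image (by fun_prop)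
  · intro p hp
    by_contra hne
    refine hp ⟨(p.1 * p.2⁻¹, p.2), ⟨subset_tsupport _ (right_ne_zero_of_mul hne),
      subset_tsupport _ (left_ne_zero_of_mul hne)⟩, by simp⟩

/-- Fubini, applied to continuous integrands of compact support on `Γ × Γ`, followed by the
substitution `x ↦ x y`. -/
theorem heckeAct_conv [μ.IsMulRightInvariant] {π : Representation ℂ Γ V} (h : IsSmooth π)
    (f f' : TestFn Γ) (v : V) :
    heckeAct μ π (TestFn.conv μ f f') v = heckeAct μ π f (heckeAct μ π f' v) := by
  refine eq_of_forall_dual fun l => ?_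
  rw [dual_heckeAct μ h, dual_heckeAct μ h]
  have h1 : ∀ x, (TestFn.conv μ f f').1 x * l (π x v) =
      ∫ y, f'.1 y * f.1 (x * y⁻¹) * l (π x v) ∂μ := fun x =>
    (integral_mul_const _ _).symm
  have h2 : ∀ x, f.1 x * l (π x (heckeAct μ π f' v)) =
      ∫ y, f.1 x * (f'.1 y * l (π x (π y v))) ∂μ := fun x => by
    rw [← LinearMap.comp_apply, dual_heckeAct μ h, integral_const_mul]
    rfl
  simp only [h1, h2]
  have hc : Continuous fun g => l (π g v) := ((isLocallyConstant_orbit h v).comp l).continuous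
  have hf := f.continuous
  have hf' := f'.continuous
  have s1 : HasCompactSupport (Function.uncurry fun x y : Γ =>
      f'.1 y * f.1 (x * y⁻¹) * l (π x v)) := (TestFn.hasCompactSupport_conv f f').mul_right
  have c1 : Continuous (Function.uncurry fun x y : Γ =>
      f'.1 y * f.1 (x * y⁻¹) * l (π x v)) := by
    have h1 : Continuous fun p : Γ × Γ => f'.1 p.2 * f.1 (p.1 * p.2⁻¹) := by fun_prop
    exact h1.mul (hc.comp continuous_fst)
  have s2 : HasCompactSupport (Function.uncurry fun x y : Γ =>
      f.1 x * (f'.1 y * l (π x (π y v)))) := by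
    refine HasCompactSupport.intro (f.2.2.prod f'.2.2) fun p hp => ?_
    by_contra hne
    exact hp ⟨subset_tsupport _ (left_ne_zero_of_mul hne),
      subset_tsupport _ (left_ne_zero_of_mul (right_ne_zero_of_mul hne))⟩
  have c2 : Continuous (Function.uncurry fun x y : Γ =>
      f.1 x * (f'.1 y * l (π x (π y v)))) := by
    simp only [← Module.End.mul_apply, ← map_mul]
    have h1 : Continuous fun p : Γ × Γ => l (π (p.1 * p.2) v) := hc.comp continuous_mul
    exact (hf.comp continuous_fst).mul ((hf'.comp continuous_snd).mul h1)
  refine (integral_integral_swap_of_hasCompactSupport c1 s1).trans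
    (Eq.trans ?_ (integral_integral_swap_of_hasCompactSupport c2 s2).symm)
  congr 1
  funext y
  -- The substitution `x ↦ x y` is where right invariance of `μ` enters.
  rw [← integral_mul_right_eq_self _ y]
  congr 1
  funext x
  simp only [mul_inv_cancel_right, map_mul, Module.End.mul_apply]
  ring

section Idempotent

variable [T2Space Γ] {K : Subgroup Γ} (hK : IsOpen (K : Set Γ)) (hKc : IsCompact (K : Set Γ))

/-- The idempotent `e_K`: the indicator function of a compact open subgroup `K`, divided by the
volume of `K`. -/
def TestFn.idem : TestFn Γ := ((μ.real (K : Set Γ) : ℂ)⁻¹) • TestFn.indicator hKc hK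

theorem real_compact_open_ne_zero {Γ : Type*} [Group Γ] [TopologicalSpace Γ]
    [MeasurableSpace Γ] (μ : Measure Γ) [μ.IsHaarMeasure] {K : Subgroup Γ}
    (hK : IsOpen (K : Set Γ)) (hKc : IsCompact (K : Set Γ)) : (μ.real (K : Set Γ) : ℂ) ≠ 0 := by
  rw [Complex.ofReal_ne_zero]
  exact (ENNReal.toReal_pos (hK.measure_ne_zero μ ⟨1, one_mem K⟩) hKc.measure_lt_top.ne).ne'

theorem TestFn.idem_apply (x : Γ) : (TestFn.idem μ hK hKc).1 x =
    (μ.real (K : Set Γ) : ℂ)⁻¹ * (K : Set Γ).indicator 1 x := rfl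

theorem integral_idem_mul {φ : Γ → ℂ} (c : ℂ) (hφ : ∀ k ∈ K, φ k = c) :
    ∫ g, (TestFn.idem μ hK hKc).1 g * φ g ∂μ = c := by
  have h1 : ∀ g, (TestFn.idem μ hK hKc).1 g * φ g =
      (μ.real (K : Set Γ) : ℂ)⁻¹ * c * (TestFn.indicator hKc hK).1 g := by
    intro g
    rw [TestFn.idem_apply, TestFn.indicator_apply]
    by_cases hg : g ∈ (K : Set Γ)
    · rw [hφ g hg]
      ring
    · simp [Set.indicator_of_notMem hg]
  simp only [h1]
  rw [integral_const_mul, TestFn.integral_indicator]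
  field_simp [real_compact_open_ne_zero μ hK hKc]

theorem heckeAct_idem {π : Representation ℂ Γ V} (h : IsSmooth π) {v : V} (hv : ∀ k ∈ K, π k v = v) :
    heckeAct μ π (TestFn.idem μ hK hKc) v = v := by
  refine eq_of_forall_dual fun l => ?_
  rw [dual_heckeAct μ h]
  exact integral_idem_mul μ hK hKc _ fun k hk => by rw [hv k hk]

theorem heckeAct_idem_invariant {π : Representation ℂ Γ V} (h : IsSmooth π) {f : TestFn Γ}
    (hf : K ≤ f.leftStab) (v : V) {k : Γ} (hk : k ∈ K) :
    π k (heckeAct μ π f v) = heckeAct μ π f v := by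
  rw [← heckeAct_leftTranslate μ h]
  congr 1
  ext x
  exact hf (inv_mem hk) x

theorem TestFn.idem_conv [μ.IsMulRightInvariant] {f : TestFn Γ} (hf : K ≤ f.leftStab) :
    TestFn.conv μ (TestFn.idem μ hK hKc) f = f := by
  ext x
  -- Substituting `h = k x` leaves `e_K(k⁻¹) f(k x)`, and `e_K` is symmetric because `K` is a
  -- subgroup.
  rw [TestFn.conv_apply, ← integral_mul_right_eq_self _ x]
  have h1 : ∀ k, f.1 (k * x) * (TestFn.idem μ hK hKc).1 (x * (k * x)⁻¹) =
      (TestFn.idem μ hK hKc).1 k * f.1 (k * x) := by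
    intro k
    rw [mul_inv_rev, mul_inv_cancel_left, mul_comm, TestFn.idem_apply, TestFn.idem_apply]
    by_cases hk : k ∈ K <;> simp [Set.indicator, hk]
  simp only [h1]
  exact integral_idem_mul μ hK hKc _ fun k hk => hf hk x

end Idempotent

end Hecke

/-! ## Integration over a closed unimodular subgroup -/

section IntegrateN

variable {Γ : Type*} [Group Γ] [TopologicalSpace Γ] [IsTopologicalGroup Γ]
  [MeasurableSpace Γ] [BorelSpace Γ] {N : Subgroup Γ}

/-- The restriction to a closed subgroup `N` of the right translate of a function by `g`. -/
def TestFn.restrict (hN : IsClosed (N : Set Γ)) (f : TestFn Γ) (g : Γ) : TestFn N :=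
  Subtype.mk (fun u => f.1 (u * g))
    ⟨f.2.1.comp_continuous (by fun_prop),
      (f.2.2.comp_homeomorph (Homeomorph.mulRight g)).comp_isClosedEmbedding
        hN.isClosedEmbedding_subtypeVal⟩

@[simp] theorem TestFn.restrict_apply (hN : IsClosed (N : Set Γ)) (f : TestFn Γ) (g : Γ) (u : N) :
    (TestFn.restrict hN f g).1 u = f.1 (u * g) := rfl

theorem RightCosets.mk_mul {u : Γ} (hu : u ∈ N) (g : Γ) :
    RightCosets.mk N (u * g) = RightCosets.mk N g := by
  rw [RightCosets.mk_eq]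
  simpa using hu

variable (μ : Measure Γ) [μ.IsHaarMeasure]
  (μN : Measure N) [μN.IsMulRightInvariant]

theorem integrateN_apply (f : TestFn Γ) (g : Γ) :
    (integrateN N μN f).1 (RightCosets.mk N g) = ∫ u : N, f.1 (u * g) ∂μN := rfl

theorem rightAct_apply (ψ : TestFn (RightCosets N)) (f : TestFn Γ) (g : Γ) :
    (rightAct μ N ψ f).1 (RightCosets.mk N g) =
      ∫ h, f.1 h * ψ.1 (RightCosets.mk N (g * h⁻¹)) ∂μ := rfl

theorem TestFn.ext_mk {ψ ψ' : TestFn (RightCosets N)}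
    (h : ∀ g, ψ.1 (RightCosets.mk N g) = ψ'.1 (RightCosets.mk N g)) : ψ = ψ' :=
  TestFn.ext fun x => Quotient.inductionOn x h

variable [IsFiniteMeasureOnCompacts μN] (hN : IsClosed (N : Set Γ))

/-- Integration over `N` as a linear map. -/
def integrateHom : TestFn Γ →ₗ[ℂ] TestFn (RightCosets N) where
  toFun := integrateN N μN
  map_add' f f' := TestFn.ext_mk fun g => by
    rw [TestFn.add_apply, integrateN_apply, integrateN_apply, integrateN_apply]
    exact integral_add ((f.restrict hN g).integrable μN) ((f'.restrict hN g).integrable μN)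
  map_smul' c f := TestFn.ext_mk fun g => integral_const_mul c _

@[simp] theorem integrateHom_apply (f : TestFn Γ) : integrateHom μN hN f = integrateN N μN f := rfl

include hN in
-- Fubini on `N × Γ`. This makes `𝒫` a map of right `ℋ(Γ)`-modules.
theorem integrateN_conv (f f' : TestFn Γ) :
    integrateN N μN (TestFn.conv μ f f') = rightAct μ N (integrateN N μN f) f' := by
  refine TestFn.ext_mk fun g => ?_
  rw [integrateN_apply, rightAct_apply]
  simp only [TestFn.conv_apply, integrateN_apply, ← integral_const_mul]
  have hf := f.continuous
  have hf' := f'.continuous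
  rw [integral_integral_swap_of_hasCompactSupport]
  · simp only [mul_assoc]
  · have : Continuous fun p : N × Γ => f'.1 p.2 * f.1 (p.1 * g * p.2⁻¹) := by fun_prop
    exact this
  · have he : IsClosedEmbedding (Prod.map (Subtype.val : N → Γ) (id : Γ → Γ)) :=
      hN.isClosedEmbedding_subtypeVal.prodMap .id
    -- Closedness of `N` in `Γ` makes the preimage in `N × Γ` of a compact set compact.
    refine HasCompactSupport.intro (K := Prod.map (Subtype.val : N → Γ) (id : Γ → Γ) ⁻¹'
      ((fun q : Γ × Γ => (q.1 * q.2 * g⁻¹, q.2)) '' (tsupport f.1 ×ˢ tsupport f'.1)))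
      (he.isCompact_preimage ((f.2.2.prod f'.2.2).image (by fun_prop))) ?_
    intro p hp
    by_contra hne
    refine hp ⟨(p.1 * g * p.2⁻¹, p.2), ⟨subset_tsupport _ (right_ne_zero_of_mul hne),
      subset_tsupport _ (left_ne_zero_of_mul hne)⟩, by simp [Prod.map]⟩

include hN in
theorem integrateN_leftTranslate [μN.IsMulLeftInvariant] {u : Γ} (hu : u ∈ N)
    (f : TestFn Γ) : integrateN N μN (TestFn.leftTranslate u f) = integrateN N μN f := by
  refine TestFn.ext_mk fun g => ?_
  have := integral_mul_left_eq_self (μ := μN) (f.restrict hN g).1 ⟨u, hu⟩⁻¹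
  simpa [integrateN_apply, mul_assoc] using this

variable [T2Space Γ] [μN.IsOpenPosMeasure]

include hN in
-- The value is the volume of the slice `{u | u g ∈ C}`, which is compact, open and contains 1.
theorem integrateN_indicator_ne_zero {C : Set Γ} (hC : IsCompact C) (ho : IsOpen C) {g : Γ}
    (hg : g ∈ C) : (integrateN N μN (TestFn.indicator hC ho)).1 (RightCosets.mk N g) ≠ 0 := by
  set D : Set N := (fun u : N => (u : Γ) * g) ⁻¹' C
  have hDo : IsOpen D := ho.preimage (by fun_prop)
  have he : IsClosedEmbedding fun u : N => (u : Γ) * g :=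
    (Homeomorph.mulRight g).isClosedEmbedding.comp hN.isClosedEmbedding_subtypeVal
  have hDc : IsCompact D := he.isCompact_preimage hC
  have : (integrateN N μN (TestFn.indicator hC ho)).1 (RightCosets.mk N g) = μN.real D :=
    TestFn.integral_indicator μN hDc hDo
  rw [this, Complex.ofReal_ne_zero]
  exact (ENNReal.toReal_pos (hDo.measure_ne_zero μN ⟨1, by simpa [D] using hg⟩)
    hDc.measure_lt_top.ne).ne'

variable [LocallyCompactSpace Γ] [TotallyDisconnectedSpace Γ]

/-- A compact subset of `N \ Γ` lies in the image of a compact open subset of `Γ`. -/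
theorem exists_compact_open_lift {S : Set (RightCosets N)} (hS : IsCompact S) :
    ∃ C : Set Γ, IsCompact C ∧ IsOpen C ∧ S ⊆ RightCosets.mk N '' C := by
  obtain ⟨K, hKo, hKc, -⟩ := exists_compact_open_subgroup (Γ := Γ) Filter.univ_mem
  have hq := RightCosets.isOpenQuotientMap_mk N
  have ho : ∀ g : Γ, IsOpen ((fun x => g * x) '' (K : Set Γ)) := fun g =>
    (Homeomorph.mulLeft g).isOpenMap _ hKo
  obtain ⟨t, ht⟩ := hS.elim_finite_subcover
    (fun g : Γ => RightCosets.mk N '' ((fun x => g * x) '' (K : Set Γ)))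
    (fun g => hq.isOpenMap _ (ho g)) (fun x _ => by
      obtain ⟨g, rfl⟩ := hq.surjective x
      exact Set.mem_iUnion.2 ⟨g, g, ⟨1, one_mem K, mul_one g⟩, rfl⟩)
  refine ⟨⋃ g ∈ t, (fun x => g * x) '' (K : Set Γ),
    t.isCompact_biUnion fun g _ => hKc.image (continuous_const_mul g),
    isOpen_biUnion fun g _ => ho g, ?_⟩
  rw [Set.image_iUnion₂]
  exact ht

include hN in
theorem integrateN_surjective : Function.Surjective (integrateN N μN) := by
  intro ψ
  obtain ⟨C, hC, ho, hψC⟩ := exists_compact_open_lift (N := N) ψ.2.2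
  set h := TestFn.indicator hC ho
  have hq := (RightCosets.isOpenQuotientMap_mk N).continuous
  -- The quotient `ψ / 𝒫(h)` is constant on cosets, so it passes through the integral. Where `𝒫(h) =
  -- 0` it takes the default value 0; `ψ` vanishes there too, since its support lies in the image of
  -- `C`.
  let f : TestFn Γ := Subtype.mk
    (fun g => h.1 g * (ψ.1 (RightCosets.mk N g) / (integrateN N μN h).1 (RightCosets.mk N g)))
    ⟨h.2.1.mul (((ψ.2.1.comp_continuous hq).prodMk
      ((integrateN N μN h).2.1.comp_continuous hq)).comp fun p => p.1 / p.2), h.2.2.mul_right⟩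
  refine ⟨f, TestFn.ext_mk fun g => ?_⟩
  have h1 : ∀ u : N, f.1 (u * g) = h.1 (u * g) *
      (ψ.1 (RightCosets.mk N g) / (integrateN N μN h).1 (RightCosets.mk N g)) := by
    intro u
    change _ * _ = _
    rw [RightCosets.mk_mul u.2]
  rw [integrateN_apply]
  simp only [h1]
  rw [integral_mul_const, ← integrateN_apply]
  by_cases hz : ψ.1 (RightCosets.mk N g) = 0
  · simp [hz]
  · obtain ⟨c, hc, hcg⟩ := hψC (subset_tsupport _ hz)
    rw [mul_div_cancel₀]
    rw [← hcg]
    exact integrateN_indicator_ne_zero μN hN hC ho hc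

section Cosets

variable {K : Subgroup Γ} (hKo : IsOpen (K : Set Γ)) (hKc : IsCompact (K : Set Γ))

/-- The indicator function of a left coset of a compact open subgroup. -/
def TestFn.coset (x : Γ ⧸ K) : TestFn Γ :=
  TestFn.indicator (C := {g : Γ | (g : Γ ⧸ K) = x})
    (by
      obtain ⟨g, rfl⟩ := QuotientGroup.mk_surjective x
      convert hKc.image (continuous_const_mul g) using 1
      ext y
      simp only [Set.mem_ofPred_eq, Set.image_mul_left, Set.mem_preimage, SetLike.mem_coe]
      rw [eq_comm, QuotientGroup.eq])
    (by
      obtain ⟨g, rfl⟩ := QuotientGroup.mk_surjective x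
      convert (Homeomorph.mulLeft g).isOpenMap _ hKo using 1
      ext y
      simp only [Set.mem_ofPred_eq, Homeomorph.coe_mulLeft, Set.image_mul_left, Set.mem_preimage,
        SetLike.mem_coe]
      rw [eq_comm, QuotientGroup.eq])

open Classical in
theorem TestFn.coset_apply (x : Γ ⧸ K) (g : Γ) :
    (TestFn.coset hKo hKc x).1 g = if (g : Γ ⧸ K) = x then 1 else 0 := by
  simp [TestFn.coset, TestFn.indicator_apply, Set.indicator_apply]

theorem TestFn.leftTranslate_coset (u : Γ) (x : Γ ⧸ K) :
    TestFn.leftTranslate u (TestFn.coset hKo hKc x) = TestFn.coset hKo hKc (u • x) := by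
  ext g
  rw [TestFn.leftTranslate_apply, TestFn.coset_apply, TestFn.coset_apply]
  congr 1
  rw [← smul_eq_mul, ← MulAction.Quotient.smul_coe, inv_smul_eq_iff]

/-- `Γ ⧸ K` is discrete because `K` is open, so the compact support meets only finitely many cosets,
and `f` is constant on each. -/
theorem TestFn.eq_sum_coset (f : TestFn Γ) (hf : K ≤ f.rightStab) :
    ∃ (S : Finset (Γ ⧸ K)) (a : Γ ⧸ K → ℂ), f = ∑ x ∈ S, a x • TestFn.coset hKo hKc x := by
  classical
  have hdisc : DiscreteTopology (Γ ⧸ K) := QuotientGroup.discreteTopology hKo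
  have hfin : (((↑) : Γ → Γ ⧸ K) '' tsupport f.1).Finite :=
    isCompact_iff_finite.1 (IsCompact.image f.2.2 QuotientGroup.continuous_mk)
  refine ⟨hfin.toFinset, fun x => f.1 x.out, TestFn.ext fun g => ?_⟩
  have hout : f.1 (Quotient.out (g : Γ ⧸ K)) = f.1 g := by
    obtain ⟨k, hk⟩ := QuotientGroup.mk_out_eq_mul K g
    rw [hk]
    exact hf k.2 g
  rw [TestFn.sum_apply]
  simp only [TestFn.smul_apply, TestFn.coset_apply, mul_ite, mul_one, mul_zero,
    Finset.sum_ite_eq, hout, Set.Finite.mem_toFinset]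
  split_ifs with h
  · rfl
  · by_contra hne
    exact h ⟨g, subset_tsupport _ hne, rfl⟩

end Cosets

include hN in
/-- A linear map on `ℋ(Γ)` that is invariant under left translation by `N` factors through
integration over `N`. -/
theorem eq_zero_of_integrateN_eq_zero [μN.IsMulLeftInvariant] {W : Type*}
    [AddCommGroup W] [Module ℂ W] (L : TestFn Γ →ₗ[ℂ] W)
    (hL : ∀ u ∈ N, ∀ f, L (TestFn.leftTranslate u f) = L f) {f : TestFn Γ}
    (hf : integrateN N μN f = 0) : L f = 0 := by
  classical
  obtain ⟨K, hKo, hKc, hK⟩ :=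
    exists_compact_open_subgroup (f.isOpen_rightStab.mem_nhds (one_mem f.rightStab))
  obtain ⟨S, a, hfS⟩ := f.eq_sum_coset hKo hKc hK
  -- The proof groups the cosets `g K` by `N`-orbit. Indicators in one orbit have the same image
  -- under both `L` and `𝒫`; those from different orbits have images under `𝒫` with disjoint
  -- supports.
  let o : Γ ⧸ K → MulAction.orbitRel.Quotient N (Γ ⧸ K) := Quotient.mk _
  have ho : ∀ x y, o x = o y → ∃ u ∈ N, u • y = x := by
    intro x y h
    obtain ⟨u, hu⟩ := MulAction.orbitRel_apply.1 (Quotient.exact h)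
    exact ⟨u, u.2, hu⟩
  have hLo : ∀ x y, o x = o y → L (TestFn.coset hKo hKc x) = L (TestFn.coset hKo hKc y) := by
    intro x y h
    obtain ⟨u, hu, rfl⟩ := ho x y h
    rw [← TestFn.leftTranslate_coset, hL u hu]
  -- Evaluating `𝒫(f) = 0` at `N g` leaves only the orbit of `g K`, whose members all contribute the
  -- same nonzero value `c`. Hence the coefficients over each orbit sum to 0.
  have hsum : ∀ y, ∑ x ∈ S with o x = o y, a x = 0 := by
    intro y
    obtain ⟨g, rfl⟩ := QuotientGroup.mk_surjective y
    set c := (integrateN N μN (TestFn.coset hKo hKc (g : Γ ⧸ K))).1 (RightCosets.mk N g) with hc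
    have hc0 : c ≠ 0 := integrateN_indicator_ne_zero μN hN _ _ rfl
    have h1 : ∀ x, (integrateN N μN (TestFn.coset hKo hKc x)).1 (RightCosets.mk N g) =
        if o x = o (g : Γ ⧸ K) then c else 0 := by
      intro x
      split_ifs with h
      · obtain ⟨u, hu, rfl⟩ := ho _ _ h
        rw [← TestFn.leftTranslate_coset, integrateN_leftTranslate μN hN hu]
      · rw [integrateN_apply]
        refine integral_eq_zero_of_ae (Filter.Eventually.of_forall fun u => ?_)
        change (TestFn.coset hKo hKc x).1 (u * g) = 0
        rw [TestFn.coset_apply, if_neg]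
        rintro rfl
        exact h (Quotient.sound (MulAction.orbitRel_apply.2 ⟨u, rfl⟩))
    have h2 : (integrateHom μN hN f).1 (RightCosets.mk N g) = 0 := by
      rw [integrateHom_apply, hf]
      rfl
    rw [hfS, map_sum, TestFn.sum_apply] at h2
    simp only [map_smul, TestFn.smul_apply, integrateHom_apply, h1, mul_ite, mul_zero] at h2
    rw [← Finset.sum_filter, ← Finset.sum_mul] at h2
    exact (mul_eq_zero.1 h2).resolve_right hc0
  rw [hfS, map_sum, ← Finset.sum_fiberwise_of_maps_to (t := S.image o)
    fun x hx => Finset.mem_image_of_mem o hx]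
  refine Finset.sum_eq_zero fun q hq => ?_
  obtain ⟨y, -, rfl⟩ := Finset.mem_image.1 hq
  have h3 : ∀ x ∈ S.filter (fun x => o x = o y), L (a x • TestFn.coset hKo hKc x) =
      a x • L (TestFn.coset hKo hKc y) := by
    intro x hx
    rw [map_smul, hLo x y (Finset.mem_filter.1 hx).2]
  rw [Finset.sum_congr rfl h3, ← Finset.sum_smul, hsum, zero_smul]

end IntegrateN

/-! ## The isomorphism with the Jacquet module -/

section Tensor

variable {Γ : Type*} [Group Γ] [TopologicalSpace Γ] [IsTopologicalGroup Γ]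
  [MeasurableSpace Γ] [BorelSpace Γ] {N : Subgroup Γ}
  (μ : Measure Γ) [μ.IsHaarMeasure]
  {V : Type*} [AddCommGroup V] [Module ℂ V] {π : Representation ℂ Γ V}

variable (N π) in
/-- The class of `ψ ⊗ v` as a bilinear map. -/
def heckeTensorMk : TestFn (RightCosets N) →ₗ[ℂ] V →ₗ[ℂ] HeckeTensor μ N π :=
  (TensorProduct.mk ℂ (TestFn (RightCosets N)) V).compr₂ (heckeRelations μ N π).mkQ

theorem HeckeTensor.mk_rightAct (ψ : TestFn (RightCosets N)) (f : TestFn Γ) (v : V) :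
    HeckeTensor.mk μ N π (rightAct μ N ψ f) v = HeckeTensor.mk μ N π ψ (heckeAct μ π f v) :=
  (Submodule.Quotient.eq _).2 (Submodule.subset_span ⟨ψ, f, v, rfl⟩)

theorem HeckeTensor.induction {p : HeckeTensor μ N π → Prop} (hmk : ∀ ψ v, p (.mk μ N π ψ v))
    (h0 : p 0) (hadd : ∀ x y, p x → p y → p (x + y)) (x : HeckeTensor μ N π) : p x := by
  obtain ⟨t, rfl⟩ := Submodule.mkQ_surjective _ x
  induction t using TensorProduct.induction_on with
  | zero => rwa [map_zero]
  | tmul ψ v => exact hmk ψ v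
  | add a b ha hb => rw [map_add]; exact hadd _ _ ha hb

theorem HeckeTensor.hom_ext {W : Type*} [AddCommGroup W] [Module ℂ W]
    {A B : HeckeTensor μ N π →ₗ[ℂ] W}
    (h : ∀ ψ v, A (.mk μ N π ψ v) = B (.mk μ N π ψ v)) : A = B := by
  refine LinearMap.ext fun x => ?_
  induction x using HeckeTensor.induction with
  | hmk ψ v => exact h ψ v
  | h0 => simp
  | hadd x y hx hy => rw [map_add, map_add, hx, hy]

theorem jacquet_mkQ_invariant {u : Γ} (hu : u ∈ N) (v : V) :
    (jacquetKer N π).mkQ (π u v) = (jacquetKer N π).mkQ v :=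
  have h : v - π u v ∈ jacquetKer N π := Submodule.subset_span ⟨v, u, hu, rfl⟩
  ((Submodule.Quotient.eq _).2 h).symm

variable [μ.IsMulRightInvariant] (μN : Measure N) [μN.IsMulRightInvariant]
  [IsFiniteMeasureOnCompacts μN] [μN.IsOpenPosMeasure] (hN : IsClosed (N : Set Γ))
  [μN.IsMulLeftInvariant] [T2Space Γ] [LocallyCompactSpace Γ]
  [TotallyDisconnectedSpace Γ] (hπ : IsSmooth π)

include hN hπ in
theorem jacquet_mkQ_heckeAct_eq {f f' : TestFn Γ}
    (h : integrateN N μN f = integrateN N μN f') (v : V) :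
    (jacquetKer N π).mkQ (heckeAct μ π f v) = (jacquetKer N π).mkQ (heckeAct μ π f' v) := by
  have key := eq_zero_of_integrateN_eq_zero μN hN
    ((jacquetKer N π).mkQ ∘ₗ (heckeHom μ hπ).flip v) (f := f - f') ?_ ?_
  · rw [map_sub, sub_eq_zero] at key
    exact key
  · intro u hu f
    simp only [LinearMap.comp_apply, LinearMap.flip_apply, heckeHom_apply]
    rw [heckeAct_leftTranslate μ hπ, jacquet_mkQ_invariant hu]
  · have := map_sub (integrateHom μN hN) f f'
    rwa [integrateHom_apply, integrateHom_apply, integrateHom_apply, h, sub_self] at this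

/-- The map `𝒫(f) ⊗ v ↦ π(f) v + V(N)`. -/
def heckeTensorToJacquet : HeckeTensor μ N π →ₗ[ℂ] Jacquet N π :=
  -- An arbitrary section of `𝒫`. It need not be linear, but by `key` the class in the Jacquet
  -- module does not depend on the lift.
  let s := Function.surjInv (integrateN_surjective μN hN)
  have hs : ∀ ψ, integrateN N μN (s ψ) = ψ := Function.surjInv_eq _
  have key := fun f f' h => jacquet_mkQ_heckeAct_eq μ μN hN hπ (f := f) (f' := f') h
  Submodule.liftQ _
    (TensorProduct.lift (LinearMap.mk₂ ℂ
      (fun ψ v => (jacquetKer N π).mkQ (heckeHom μ hπ (s ψ) v))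
      (fun ψ ψ' v => by
        rw [← map_add, ← LinearMap.add_apply, ← map_add]
        refine key _ _ ?_ v
        have := map_add (integrateHom μN hN) (s ψ) (s ψ')
        simp only [integrateHom_apply, hs] at this
        rw [hs, this])
      (fun c ψ v => by
        rw [← map_smul, ← LinearMap.smul_apply, ← map_smul]
        refine key _ _ ?_ v
        have := map_smul (integrateHom μN hN) c (s ψ)
        simp only [integrateHom_apply, hs] at this
        rw [hs, this])
      (fun ψ v w => by simp only [map_add])
      (fun c ψ v => by simp only [map_smul])))
    (by
      rw [heckeRelations, Submodule.span_le]
      rintro _ ⟨ψ, f, v, rfl⟩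
      rw [SetLike.mem_coe, LinearMap.mem_ker, map_sub, TensorProduct.lift.tmul,
        TensorProduct.lift.tmul, LinearMap.mk₂_apply, LinearMap.mk₂_apply, sub_eq_zero,
        heckeHom_apply, heckeHom_apply, ← heckeAct_conv μ hπ]
      -- Both `s (ψ f)` and the convolution of `s ψ` with `f` lift `ψ f`.
      refine key _ _ ?_ v
      rw [hs, integrateN_conv μ μN hN, hs])

theorem heckeTensorToJacquet_mk (f : TestFn Γ) (v : V) :
    heckeTensorToJacquet μ μN hN hπ (.mk μ N π (integrateN N μN f) v) =
      (jacquetKer N π).mkQ (heckeAct μ π f v) :=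
  jacquet_mkQ_heckeAct_eq μ μN hN hπ
    (Function.surjInv_eq (integrateN_surjective μN hN) _) v

section Idempotent

variable {K : Subgroup Γ} (hKo : IsOpen (K : Set Γ)) (hKc : IsCompact (K : Set Γ))

include hN in
-- Since `f = e_K f`, the factor `f` can be moved across the tensor sign. Every property of the
-- inverse map comes from this.
theorem HeckeTensor.mk_integrateN {f : TestFn Γ} (hf : K ≤ f.leftStab) (v : V) :
    HeckeTensor.mk μ N π (integrateN N μN f) v =
      .mk μ N π (integrateN N μN (TestFn.idem μ hKo hKc)) (heckeAct μ π f v) := by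
  rw [← HeckeTensor.mk_rightAct, ← integrateN_conv μ μN hN, TestFn.idem_conv μ hKo hKc hf]

variable {K' : Subgroup Γ} (hKo' : IsOpen (K' : Set Γ)) (hKc' : IsCompact (K' : Set Γ))

include hπ hN in
-- `e_K` is left `K'`-invariant and `π(e_K) v = v`, so `𝒫(e_K) ⊗ v = 𝒫(e_K') ⊗ π(e_K) v = 𝒫(e_K') ⊗
-- v`.
theorem HeckeTensor.mk_idem_mono (h : K' ≤ K) {v : V} (hv : K ≤ fixator π v) :
    HeckeTensor.mk μ N π (integrateN N μN (TestFn.idem μ hKo hKc)) v =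
      .mk μ N π (integrateN N μN (TestFn.idem μ hKo' hKc')) v := by
  rw [HeckeTensor.mk_integrateN μ μN hN hKo' hKc', heckeAct_idem μ hKo hKc hπ fun k hk => hv hk]
  intro k hk g
  rw [TestFn.idem_apply, TestFn.idem_apply]
  congr 1
  by_cases hg : g ∈ K <;> simp [Set.indicator, hg, K.mul_mem_cancel_left (h hk)]

include hπ hN in
theorem HeckeTensor.mk_idem_eq {v : V} (hv : K ≤ fixator π v) (hv' : K' ≤ fixator π v) :
    HeckeTensor.mk μ N π (integrateN N μN (TestFn.idem μ hKo hKc)) v =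
      .mk μ N π (integrateN N μN (TestFn.idem μ hKo' hKc')) v := by
  have ho : IsOpen ((K ⊓ K' : Subgroup Γ) : Set Γ) := hKo.inter hKo'
  have hc : IsCompact ((K ⊓ K' : Subgroup Γ) : Set Γ) :=
    hKc.inter_right hKc'.isClosed
  rw [HeckeTensor.mk_idem_mono μ μN hN hπ hKo hKc ho hc inf_le_left hv,
    HeckeTensor.mk_idem_mono μ μN hN hπ hKo' hKc' ho hc inf_le_right hv']

end Idempotent

theorem exists_compact_open_le {H : Subgroup Γ} (hH : IsOpen (H : Set Γ)) :
    ∃ K : Subgroup Γ, IsOpen (K : Set Γ) ∧ IsCompact (K : Set Γ) ∧ K ≤ H :=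
  exists_compact_open_subgroup (hH.mem_nhds (one_mem H))

/-- The vector `𝒫(e_K) ⊗ v` for small compact open subgroups `K`. -/
def idemTensor (v : V) : HeckeTensor μ N π :=
  have h := exists_compact_open_le (hπ.isOpen_fixator v)
  .mk μ N π (integrateN N μN (TestFn.idem μ h.choose_spec.1 h.choose_spec.2.1)) v

include hN in
theorem idemTensor_eq {K : Subgroup Γ} (hKo : IsOpen (K : Set Γ)) (hKc : IsCompact (K : Set Γ))
    {v : V} (hv : K ≤ fixator π v) :
    idemTensor μ μN hπ v = .mk μ N π (integrateN N μN (TestFn.idem μ hKo hKc)) v :=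
  HeckeTensor.mk_idem_eq μ μN hN hπ _ _ _ _
    (exists_compact_open_le (hπ.isOpen_fixator v)).choose_spec.2.2 hv

include hN in
-- A compact open `K` in the left stabilizer of `f` fixes `π(f) v`, so it may be used to compute the
-- left side.
theorem idemTensor_heckeAct (f : TestFn Γ) (v : V) :
    idemTensor μ μN hπ (heckeAct μ π f v) = .mk μ N π (integrateN N μN f) v := by
  obtain ⟨K, hKo, hKc, hK⟩ := exists_compact_open_le f.isOpen_leftStab
  rw [HeckeTensor.mk_integrateN μ μN hN hKo hKc hK]
  exact idemTensor_eq μ μN hN hπ hKo hKc fun k hk => heckeAct_idem_invariant μ hπ hK v hk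

include hN in
-- With `v = π(e_K) v`, the vector `π(u) v` is the action on `v` of the left translate of `e_K` by
-- `u`, and `𝒫` does not see that translation.
theorem idemTensor_invariant {u : Γ} (hu : u ∈ N) (v : V) :
    idemTensor μ μN hπ (π u v) = idemTensor μ μN hπ v := by
  obtain ⟨K, hKo, hKc, hK⟩ := exists_compact_open_le (hπ.isOpen_fixator v)
  have hv : heckeAct μ π (TestFn.idem μ hKo hKc) v = v := heckeAct_idem μ hKo hKc hπ hK
  conv_lhs => rw [← hv, ← heckeAct_leftTranslate μ hπ, idemTensor_heckeAct μ μN hN hπ,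
    integrateN_leftTranslate μN hN hu]
  exact (idemTensor_eq μ μN hN hπ hKo hKc hK).symm

/-- The map `v ↦ 𝒫(e_K) ⊗ v` is linear. -/
def idemTensorHom : V →ₗ[ℂ] HeckeTensor μ N π where
  toFun := idemTensor μ μN hπ
  map_add' v w := by
    obtain ⟨K, hKo, hKc, hK⟩ := exists_compact_open_le (H := fixator π v ⊓ fixator π w)
      ((hπ.isOpen_fixator v).inter (hπ.isOpen_fixator w))
    have h : K ≤ fixator π (v + w) := fun k hk => by
      rw [mem_fixator, map_add, mem_fixator.1 (hK hk).1, mem_fixator.1 (hK hk).2]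
    rw [idemTensor_eq μ μN hN hπ hKo hKc h, idemTensor_eq μ μN hN hπ hKo hKc fun k hk => (hK hk).1,
      idemTensor_eq μ μN hN hπ hKo hKc fun k hk => (hK hk).2]
    exact map_add (heckeTensorMk N μ π _) v w
  map_smul' c v := by
    obtain ⟨K, hKo, hKc, hK⟩ := exists_compact_open_le (hπ.isOpen_fixator v)
    have h : K ≤ fixator π (c • v) := fun k hk => by
      rw [mem_fixator, map_smul, mem_fixator.1 (hK hk)]
    rw [idemTensor_eq μ μN hN hπ hKo hKc h, idemTensor_eq μ μN hN hπ hKo hKc hK]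
    exact map_smul (heckeTensorMk N μ π _) c v

/-- The inverse isomorphism `v + V(N) ↦ 𝒫(e_K) ⊗ v`. -/
def jacquetToHeckeTensor : Jacquet N π →ₗ[ℂ] HeckeTensor μ N π :=
  Submodule.liftQ _ (idemTensorHom μ μN hN hπ) <| by
    rw [jacquetKer, Submodule.span_le]
    rintro _ ⟨v, u, hu, rfl⟩
    rw [SetLike.mem_coe, LinearMap.mem_ker, map_sub, sub_eq_zero]
    exact (idemTensor_invariant μ μN hN hπ hu v).symm

theorem jacquetToHeckeTensor_mkQ (v : V) :
    jacquetToHeckeTensor μ μN hN hπ ((jacquetKer N π).mkQ v) = idemTensor μ μN hπ v := rfl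

/-- The isomorphism `ℋ(N \ Γ) ⊗_{ℋ(Γ)} V ≅ J_N(π)` with `𝒫(f) ⊗ v ↦ π(f) v + V(N)`. -/
def heckeTensorEquivJacquet : HeckeTensor μ N π ≃ₗ[ℂ] Jacquet N π :=
  LinearEquiv.ofLinearMap (heckeTensorToJacquet μ μN hN hπ)
    (jacquetToHeckeTensor μ μN hN hπ)
    (by
      ext v
      obtain ⟨K, hKo, hKc, hK⟩ := exists_compact_open_le (hπ.isOpen_fixator v)
      simp only [LinearMap.comp_apply, LinearMap.id_apply]
      rw [jacquetToHeckeTensor_mkQ, idemTensor_eq μ μN hN hπ hKo hKc hK, heckeTensorToJacquet_mk,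
        heckeAct_idem μ hKo hKc hπ hK])
    (HeckeTensor.hom_ext μ fun ψ v => by
      obtain ⟨f, rfl⟩ := integrateN_surjective μN hN ψ
      simp only [LinearMap.comp_apply, LinearMap.id_apply]
      rw [heckeTensorToJacquet_mk, jacquetToHeckeTensor_mkQ, idemTensor_heckeAct μ μN hN hπ])

theorem heckeTensorEquivJacquet_mk (f : TestFn Γ) (v : V) :
    heckeTensorEquivJacquet μ μN hN hπ (.mk μ N π (integrateN N μN f) v) =
      (jacquetKer N π).mkQ (heckeAct μ π f v) :=
  heckeTensorToJacquet_mk μ μN hN hπ f v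

theorem heckeTensorEquivJacquet_natural {V' : Type*} [AddCommGroup V'] [Module ℂ V']
    {π' : Representation ℂ Γ V'} (hπ' : IsSmooth π') (A : V →ₗ[ℂ] V')
    (hA : ∀ g v, A (π g v) = π' g (A v)) (ψ : TestFn (RightCosets N)) (v : V) :
    heckeTensorEquivJacquet μ μN hN hπ' (.mk μ N π' ψ (A v)) =
      jacquetMap N π π' A hA (heckeTensorEquivJacquet μ μN hN hπ (.mk μ N π ψ v)) := by
  obtain ⟨f, rfl⟩ := integrateN_surjective μN hN ψ
  rw [heckeTensorEquivJacquet_mk, heckeTensorEquivJacquet_mk, ← map_heckeAct μ hπ A hA]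
  rfl

end Tensor

/-! ## The action of the Levi subgroup -/

section Levi

variable {Γ : Type*} [Group Γ] [TopologicalSpace Γ] [IsTopologicalGroup Γ]
  {M N : Subgroup Γ} (hMN : M ≤ Subgroup.normalizer (N : Set Γ))

theorem isSmooth_translation : IsSmooth (translation hMN) := by
  intro ψ
  refine ⟨fixator (translation hMN) ψ, ?_, fun k hk => hk⟩
  have hc : Continuous fun p : M × RightCosets N => RightCosets.mulLeft hMN p.1⁻¹ p.2 :=
    (RightCosets.continuous_mulLeft hMN).comp (continuous_fst.inv.prodMk continuous_snd)
  have key : ∀ᶠ m in 𝓝 (1 : M), ∀ x ∈ tsupport ψ.1,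
      ψ.1 (RightCosets.mulLeft hMN m⁻¹ x) = ψ.1 x := by
    refine ψ.2.2.eventually_forall_of_forall_eventually fun x _ => ?_
    have h1 : IsLocallyConstant fun p : M × RightCosets N =>
        ψ.1 (RightCosets.mulLeft hMN p.1⁻¹ p.2) := ψ.2.1.comp_continuous hc
    have h2 : IsLocallyConstant fun p : M × RightCosets N => ψ.1 p.2 :=
      ψ.2.1.comp_continuous continuous_snd
    filter_upwards [h1.eventually_eq (1, x), h2.eventually_eq (1, x)] with p hp hp'
    rw [hp, hp', inv_one, RightCosets.mulLeft_one]
  -- Control on the support alone does not exclude that `m` moves a point outside the support into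
  -- it; the inverse translation handles this case.
  have key' : ∀ᶠ m in 𝓝 (1 : M), ∀ x ∈ tsupport ψ.1,
      ψ.1 (RightCosets.mulLeft hMN m x) = ψ.1 x := by
    have : Filter.Tendsto (fun m : M => m⁻¹) (𝓝 1) (𝓝 1) := by
      simpa using (continuous_inv (G := M)).tendsto 1
    filter_upwards [this.eventually key] with m hm
    simpa using hm
  refine Subgroup.isOpen_of_mem_nhds _ (g := 1) (Filter.mem_of_superset (key.and key') ?_)
  rintro m ⟨h1, h2⟩
  refine TestFn.ext fun x => ?_
  change ψ.1 (RightCosets.mulLeft hMN m⁻¹ x) = ψ.1 x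
  by_cases hx : ψ.1 x = 0
  · by_contra hne
    have h3 : ψ.1 (RightCosets.mulLeft hMN m⁻¹ x) ≠ 0 := fun h => hne (h.trans hx.symm)
    have h4 := h2 _ (subset_tsupport _ h3)
    rw [RightCosets.mulLeft_mul, mul_inv_cancel, RightCosets.mulLeft_one] at h4
    exact hne h4.symm
  · exact h1 x (subset_tsupport _ hx)

variable [MeasurableSpace Γ] [BorelSpace Γ] (μ : Measure Γ) [μ.IsHaarMeasure]
  {V : Type*} [AddCommGroup V] [Module ℂ V] {π : Representation ℂ Γ V}

theorem tensorRep_mk (m : M) (ψ : TestFn (RightCosets N)) (v : V) :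
    tensorRep hMN μ π m (.mk μ N π ψ v) = .mk μ N π (translation hMN m ψ) v := rfl

theorem isSmooth_tensorRep : IsSmooth (tensorRep hMN μ π) := by
  intro x
  induction x using HeckeTensor.induction with
  | hmk ψ v =>
    obtain ⟨K, hK, h⟩ := isSmooth_translation hMN ψ
    exact ⟨K, hK, fun k hk => by rw [tensorRep_mk, h k hk]⟩
  | h0 => exact ⟨⊤, isOpen_univ, fun k _ => map_zero _⟩
  | hadd x y hx hy =>
    obtain ⟨K, hK, h⟩ := hx
    obtain ⟨K', hK', h'⟩ := hy
    exact ⟨K ⊓ K', hK.inter hK', fun k hk => by rw [map_add, h k hk.1, h' k hk.2]⟩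

theorem heckeAct_translation (μM : Measure M) [IsFiniteMeasureOnCompacts μM] (φ : TestFn M)
    (ψ : TestFn (RightCosets N)) : heckeAct μM (translation hMN) φ ψ = leftAct hMN μM φ ψ := by
  ext x
  have := dual_heckeAct μM (isSmooth_translation hMN) φ ψ (TestFn.eval x)
  exact this

/-- The map `ψ ↦ ψ ⊗ v` is `M`-equivariant, so it commutes with the action of `ℋ(M)`; on `ℋ(N \ Γ)`
that action is found by evaluating at points. -/
theorem heckeAct_tensorRep (μM : Measure M) [μM.IsHaarMeasure] (φ : TestFn M)
    (ψ : TestFn (RightCosets N)) (v : V) :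
    heckeAct μM (tensorRep hMN μ π) φ (.mk μ N π ψ v) =
      .mk μ N π (leftAct hMN μM φ ψ) v := by
  rw [← heckeAct_translation]
  exact (map_heckeAct μM (isSmooth_translation hMN) ((heckeTensorMk N μ π).flip v)
    (fun m ψ => (tensorRep_mk hMN μ m ψ v).symm) φ ψ).symm

/-- Conjugation by an element of `M`, as an automorphism of `N`. -/
def conjN (m : M) : N ≃ₜ* N where
  toFun u := ⟨m * u * (m : Γ)⁻¹, (hMN m.2 u).1 u.2⟩
  invFun u := ⟨(m : Γ)⁻¹ * u * m, by
    have := (hMN (inv_mem m.2) u).1 u.2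
    rwa [inv_inv] at this⟩
  left_inv u := Subtype.ext (by simp [mul_assoc])
  right_inv u := Subtype.ext (by simp [mul_assoc])
  map_mul' u u' := Subtype.ext (by simp [mul_assoc])
  continuous_toFun := by fun_prop
  continuous_invFun := by fun_prop

@[simp] theorem conjN_coe (m : M) (u : N) : (conjN hMN m u : Γ) = m * u * (m : Γ)⁻¹ := rfl

variable (μN : Measure N) [μN.IsMulRightInvariant] [IsFiniteMeasureOnCompacts μN]
  (hN : IsClosed (N : Set Γ))

include hN in
-- `u m⁻¹ = m⁻¹ (m u m⁻¹)`, so moving `m⁻¹` to the left conjugates the variable of integration.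
theorem translation_integrateN {m : M} {c : ℂ}
    (hc : ∀ f : TestFn N, ∫ u, f.1 (conjN hMN m u) ∂μN = c * ∫ u, f.1 u ∂μN) (f : TestFn Γ) :
    translation hMN m (integrateN N μN f) =
      c • integrateN N μN (TestFn.leftTranslate (m : Γ) f) := by
  refine TestFn.ext_mk fun g => ?_
  have h := hc ((TestFn.leftTranslate (m : Γ) f).restrict hN g)
  rw [TestFn.smul_apply, integrateN_apply]
  refine Eq.trans ?_ h
  change (∫ u : N, f.1 (u * ((m⁻¹ : M) * g)) ∂μN) = _
  congr 1
  funext u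
  simp [mul_assoc]

theorem heckeTensorEquivJacquet_tensorRep [μ.IsMulRightInvariant] [μN.IsOpenPosMeasure]
    [μN.IsMulLeftInvariant] [T2Space Γ] [LocallyCompactSpace Γ]
    [TotallyDisconnectedSpace Γ] (hπ : IsSmooth π) {m : M} {c : ℂ}
    (hc : ∀ f : TestFn N, ∫ u, f.1 (conjN hMN m u) ∂μN = c * ∫ u, f.1 u ∂μN)
    (x : HeckeTensor μ N π) :
    heckeTensorEquivJacquet μ μN hN hπ (tensorRep hMN μ π m x) =
      c • jacquetRep hMN π m (heckeTensorEquivJacquet μ μN hN hπ x) := by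
  induction x using HeckeTensor.induction with
  | hmk ψ v =>
    obtain ⟨f, rfl⟩ := integrateN_surjective μN hN ψ
    have h : HeckeTensor.mk μ N π (c • integrateN N μN (TestFn.leftTranslate (m : Γ) f)) v =
        c • HeckeTensor.mk μ N π (integrateN N μN (TestFn.leftTranslate (m : Γ) f)) v :=
      (heckeTensorMk N μ π).map_smul₂ c _ v
    rw [tensorRep_mk, translation_integrateN hMN μN hN hc, h, map_smul,
      heckeTensorEquivJacquet_mk, heckeTensorEquivJacquet_mk, heckeAct_leftTranslate μ hπ]
    rfl
  | h0 => simp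
  | hadd x y hx hy => simp only [map_add, hx, hy, smul_add]

end Levi

/-! ## The modular character of a semidirect product -/

section Modulus

instance {Γ : Type*} [Group Γ] [TopologicalSpace Γ] [SecondCountableTopology Γ] (H : Subgroup Γ) :
    SecondCountableTopology H :=
  TopologicalSpace.Subtype.secondCountableTopology (H : Set Γ)

theorem continuous_inclusion {Γ : Type*} [Group Γ] [TopologicalSpace Γ] {H K : Subgroup Γ}
    (h : H ≤ K) : Continuous (Subgroup.inclusion h) :=
  continuous_subtype_val.subtype_mk _

/-- Right translation by `g` maps `K` to itself, and `K` has positive finite volume. -/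
theorem modularCharacterFun_eq_one_of_mem {A : Type*} [Group A] [TopologicalSpace A]
    [IsTopologicalGroup A] [LocallyCompactSpace A] {K : Subgroup A} (ho : IsOpen (K : Set A))
    (hc : IsCompact (K : Set A)) {g : A} (hg : g ∈ K) : Measure.modularCharacterFun g = 1 := by
  borelize A
  set ν : Measure A := Measure.haar
  rw [Measure.modularCharacterFun_eq_haarScalarFactor ν g]
  have h := Measure.measure_isMulInvariant_eq_smul_of_isCompact_closure (ν.map (· * g)) ν hc.closure
  have hpre : (· * g) ⁻¹' (K : Set A) = K := by
    ext x
    exact K.mul_mem_cancel_right hg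
  rw [Measure.map_apply (measurable_mul_const g) ho.measurableSet, hpre, ENNReal.smul_def,
    smul_eq_mul, eq_comm, ENNReal.mul_eq_right (ho.measure_ne_zero ν ⟨1, one_mem K⟩)
    hc.measure_lt_top.ne] at h
  exact_mod_cast h

/-- Some nontrivial power of `g` lies in any given neighbourhood of the identity. -/
def IsRecurrent {A : Type*} [Group A] [TopologicalSpace A] (g : A) : Prop :=
  ∀ U ∈ 𝓝 (1 : A), ∃ k : ℕ, k ≠ 0 ∧ g ^ k ∈ U

theorem IsRecurrent.modularCharacterFun_eq_one {A : Type*} [Group A] [TopologicalSpace A]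
    [IsTopologicalGroup A] [LocallyCompactSpace A] [T2Space A] [TotallyDisconnectedSpace A]
    {g : A} (hg : IsRecurrent g) : Measure.modularCharacterFun g = 1 := by
  obtain ⟨K, ho, hc, -⟩ := exists_compact_open_subgroup (Γ := A) Filter.univ_mem
  obtain ⟨k, hk, hgk⟩ := hg _ (ho.mem_nhds (one_mem K))
  have h : Measure.modularCharacter (g ^ k) = 1 := modularCharacterFun_eq_one_of_mem ho hc hgk
  rw [map_pow] at h
  -- The modular character has values in the nonnegative reals, where 1 is the only `k`-th root of
  -- 1.
  exact (pow_eq_one_iff_of_nonneg (zero_le) hk).1 h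

variable {A : Type*} [Group A] [TopologicalSpace A] [IsTopologicalGroup A] [LocallyCompactSpace A]
  [T2Space A] [TotallyDisconnectedSpace A] [SecondCountableTopology A] [MeasurableSpace A]
  [BorelSpace A]

theorem map_mul_right_eq_of_isRecurrent (ν : Measure A) [ν.IsHaarMeasure] {g : A}
    (hg : IsRecurrent g) : ν.map (· * g) = ν := by
  rw [Measure.map_right_mul_eq_modularCharacterFun_smul, hg.modularCharacterFun_eq_one, one_smul]

/-- A right Haar measure on a group all of whose elements are recurrent is left invariant. -/
theorem isMulLeftInvariant_of_isRecurrent (μ : Measure A) [μ.IsMulRightInvariant]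
    [IsFiniteMeasureOnCompacts μ] [μ.IsOpenPosMeasure] (h : ∀ g : A, IsRecurrent g) :
    μ.IsMulLeftInvariant := by
  have : μ.inv.IsOpenPosMeasure := (Homeomorph.inv A).continuous.isOpenPosMeasure_map
    (Homeomorph.inv A).surjective
  -- Inversion turns the right-invariant `μ` into a left Haar measure, which recurrence makes right
  -- invariant as well; inverting back gives left invariance of `μ`.
  have : μ.inv.IsHaarMeasure := {}
  have : μ.inv.IsMulRightInvariant := ⟨fun g => map_mul_right_eq_of_isRecurrent μ.inv (h g)⟩
  rw [← μ.inv_inv]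
  infer_instance

/-- An automorphism scales Haar measures by a constant. -/
theorem exists_map_eq_smul (ν : Measure A) [ν.IsHaarMeasure] (φ : A ≃ₜ* A) :
    ∃ c : ℝ≥0, ν.map φ = c • ν := by
  have : (ν.map φ).IsHaarMeasure := φ.isHaarMeasure_map ν
  exact ⟨_, Measure.isMulLeftInvariant_eq_smul (ν.map φ) ν⟩

variable {Γ : Type*} [Group Γ] [TopologicalSpace Γ] [IsTopologicalGroup Γ] [T2Space Γ]
  [TotallyDisconnectedSpace Γ] [SecondCountableTopology Γ] [MeasurableSpace Γ] [BorelSpace Γ]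
  {M N P : Subgroup Γ} (hMN : M ≤ Subgroup.normalizer (N : Set Γ)) (hMP : M ≤ P) (hNP : N ≤ P)
  (hdisj : M ⊓ N = ⊥) {q : P → M} (hq : Continuous q) (hqN : ∀ p, ((q p : Γ)⁻¹ * p) ∈ N)

/-- The `N`-component of an element of `P = M N`. -/
def compN {q : P → M} (hqN : ∀ p, ((q p : Γ)⁻¹ * p) ∈ N) (p : P) : N := ⟨(q p : Γ)⁻¹ * p, hqN p⟩

@[simp] theorem compN_coe (p : P) : (compN hqN p : Γ) = (q p : Γ)⁻¹ * p := rfl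

include hqN hdisj in
-- Two decompositions of `p` differ by an element of `M ∩ N = 1`. The next three lemmas read off
-- from this how translations act on the components.
theorem comp_eq {p : P} {m : M} {u : N} (h : (p : Γ) = m * u) : q p = m ∧ compN hqN p = u := by
  have h1 : ((q p : Γ)⁻¹ * m) ∈ M ⊓ N := by
    refine Subgroup.mem_inf.2 ⟨M.mul_mem (M.inv_mem (q p).2) m.2, ?_⟩
    have := mul_mem (hqN p) (inv_mem u.2)
    rwa [h, mul_assoc, mul_inv_cancel_right] at this
  rw [hdisj, Subgroup.mem_bot, inv_mul_eq_one] at h1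
  refine ⟨Subtype.ext h1, Subtype.ext ?_⟩
  rw [compN_coe, h1, h, inv_mul_cancel_left]

include hqN hdisj in
theorem comp_mul_left (m : M) (p : P) :
    q (Subgroup.inclusion hMP m * p) = m * q p ∧
      compN hqN (Subgroup.inclusion hMP m * p) = compN hqN p :=
  comp_eq hdisj hqN (by simp [mul_assoc])

include hqN hdisj in
theorem comp_mul_right (u : N) (p : P) :
    q (p * Subgroup.inclusion hNP u) = q p ∧
      compN hqN (p * Subgroup.inclusion hNP u) = compN hqN p * u :=
  comp_eq hdisj hqN (by simp [mul_assoc])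

include hqN hdisj in
theorem comp_mul_levi (m : M) (p : P) :
    q (p * Subgroup.inclusion hMP m) = q p * m ∧
      compN hqN (p * Subgroup.inclusion hMP m) = (conjN hMN m).symm (compN hqN p) := by
  have h : ((conjN hMN m).symm (compN hqN p) : Γ) = (m : Γ)⁻¹ * compN hqN p * m := rfl
  exact comp_eq hdisj hqN (by simp [h, mul_assoc])

/-- The elements of `P` with components in `B ⊆ M` and `C ⊆ N`. -/
def box {q : P → M} (hqN : ∀ p, ((q p : Γ)⁻¹ * p) ∈ N) (B : Set M) (C : Set N) : Set P :=
  q ⁻¹' B ∩ compN hqN ⁻¹' C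

include hq in
theorem continuous_compN : Continuous (compN hqN) := by
  unfold compN
  fun_prop

include hq in
theorem isOpen_box {B : Set M} {C : Set N} (hB : IsOpen B) (hC : IsOpen C) :
    IsOpen (box hqN B C) :=
  (hB.preimage hq).inter (hC.preimage (continuous_compN hq hqN))

include hMP hNP in
theorem isCompact_box (hq : Continuous q) {B : Set M} {C : Set N} (hB : IsCompact B)
    (hC : IsCompact C) : IsCompact (box hqN B C) := by
  have h : box hqN B C ⊆ (fun x : M × N => Subgroup.inclusion hMP x.1 * Subgroup.inclusion hNP x.2)
      '' (B ×ˢ C) := fun p hp => ⟨(q p, compN hqN p), hp, Subtype.ext (by simp)⟩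
  refine ((hB.prod hC).image ?_).of_isClosed_subset ?_ h
  · exact ((continuous_inclusion hMP).comp continuous_fst).mul
      ((continuous_inclusion hNP).comp continuous_snd)
  · exact (hB.isClosed.preimage hq).inter (hC.isClosed.preimage (continuous_compN hq hqN))

variable [LocallyCompactSpace M] [LocallyCompactSpace N] [LocallyCompactSpace P]
  (ν : Measure P) [ν.IsHaarMeasure]

include hMP hNP hdisj in
/-- The volume of a box is invariant under right translation of the `M`-component when `M` is
unimodular. -/
theorem measure_box_mul_right (hq : Continuous q) (μM : Measure M) [μM.IsHaarMeasure]
    [μM.IsMulRightInvariant] {C : Set N} (hC : IsCompact C) {B : Set M}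
    (hBo : IsOpen B) (m : M) : ν (box hqN ((· * m) ⁻¹' B) C) = ν (box hqN B C) := by
  have hcN := continuous_compN hq hqN
  -- For fixed `C`, the volume of the box is a left-invariant measure in `B`, hence a multiple of
  -- `μM`, which is right invariant.
  set l : Measure M := (ν.restrict (compN hqN ⁻¹' C)).map q
  have hl : ∀ {B : Set M}, MeasurableSet B → l B = ν (box hqN B C) := fun hB => by
    rw [Measure.map_apply hq.measurable hB, Measure.restrict_apply (hq.measurable hB)]
    rfl
  have hfin : IsFiniteMeasureOnCompacts l := ⟨fun K hK => by
    rw [hl hK.measurableSet]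
    exact (isCompact_box hMP hNP hqN hq hK hC).measure_lt_top⟩
  have hleft : l.IsMulLeftInvariant := by
    refine ⟨fun m => Measure.ext fun B hB => ?_⟩
    rw [Measure.map_apply (measurable_const_mul m) hB, hl (measurable_const_mul m hB), hl hB,
      ← measure_preimage_mul ν (Subgroup.inclusion hMP m) (box hqN B C)]
    congr 1
    ext p
    obtain ⟨h1, h2⟩ := comp_mul_left hMP hdisj hqN m p
    simp only [box, Set.mem_inter_iff, Set.mem_preimage, h1, h2]
  rw [← hl hBo.measurableSet, ← hl (measurable_mul_const m hBo.measurableSet),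
    Measure.isMulLeftInvariant_eq_smul l μM, Measure.smul_apply, Measure.smul_apply,
    measure_preimage_mul_right]

include hMP hNP hdisj in
/-- An automorphism of `N` scales the volume of boxes in the same way as a Haar measure of `N`. -/
theorem measure_box_conj (hq : Continuous q) (hrec : ∀ u : N, IsRecurrent u)
    (μN : Measure N) [μN.IsHaarMeasure] (φ : N ≃ₜ* N) {c : ℝ≥0} (hc : μN.map φ = c • μN)
    {B : Set M} (hBo : IsOpen B) (hB : IsCompact B) {C : Set N} (hCo : IsOpen C) :
    ν (box hqN B (φ ⁻¹' C)) = c * ν (box hqN B C) := by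
  have hcN := continuous_compN hq hqN
  -- For fixed `B`, the volume of the box is a measure in `C`. Once shown to be a multiple of `μN`,
  -- it scales under `φ` by the same `c`.
  set l : Measure N := (ν.restrict (q ⁻¹' B)).map (compN hqN)
  have hl : ∀ {C : Set N}, MeasurableSet C → l C = ν (box hqN B C) := fun hC => by
    rw [Measure.map_apply hcN.measurable hC, Measure.restrict_apply (hcN.measurable hC),
      Set.inter_comm]
    rfl
  have hfin : IsFiniteMeasureOnCompacts l := ⟨fun K hK => by
    rw [hl hK.measurableSet]
    exact (isCompact_box hMP hNP hqN hq hB hK).measure_lt_top⟩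
  -- Right translation by `u` changes only the `N`-component, and preserves `ν` because `u` is
  -- recurrent in `P` too.
  have hright : l.IsMulRightInvariant := by
    refine ⟨fun u => Measure.ext fun C hC => ?_⟩
    have hu : IsRecurrent (Subgroup.inclusion hNP u) := by
      intro U hU
      have := (continuous_inclusion hNP).tendsto 1
      rw [map_one] at this
      obtain ⟨k, hk, h⟩ := hrec u _ (this hU)
      exact ⟨k, hk, by simpa using h⟩
    rw [Measure.map_apply (measurable_mul_const u) hC, hl (measurable_mul_const u hC), hl hC]
    conv_rhs => rw [← map_mul_right_eq_of_isRecurrent ν hu]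
    rw [box, box, Measure.map_apply (measurable_mul_const _)
      ((hq.measurable hBo.measurableSet).inter (hcN.measurable hC))]
    congr 1
    ext p
    simp only [Set.mem_inter_iff, Set.mem_preimage, (comp_mul_right hNP hdisj hqN u p).1,
      (comp_mul_right hNP hdisj hqN u p).2]
  have hright' : l.IsMulLeftInvariant := by
    have h1 := Measure.isMulLeftInvariant_eq_smul l.inv μN
    have : μN.IsMulRightInvariant := ⟨fun u => map_mul_right_eq_of_isRecurrent μN (hrec u)⟩
    rw [← l.inv_inv, h1]
    infer_instance
  have hφ : MeasurableSet (φ ⁻¹' C) := (hCo.preimage φ.continuous).measurableSet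
  rw [← hl hCo.measurableSet, ← hl hφ,
    ← Measure.map_apply (f := φ) φ.continuous.measurable hCo.measurableSet,
    Measure.isMulLeftInvariant_eq_smul l μN, Measure.map_smul, hc]
  simp only [Measure.smul_apply, ENNReal.smul_def, smul_eq_mul]
  ring

include hMP hNP hdisj hqN in
/-- The modular character of `P = M N` on `M` is inverse to the factor by which conjugation scales
the Haar measure of `N`. -/
theorem modularCharacterFun_mul_eq_one (hq : Continuous q) (hrec : ∀ u : N, IsRecurrent u)
    (μM : Measure M) [μM.IsHaarMeasure] [μM.IsMulRightInvariant] (μN : Measure N)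
    [μN.IsHaarMeasure] {m : M} {c : ℝ≥0} (hc : μN.map (conjN hMN m) = c • μN) :
    Measure.modularCharacterFun (Subgroup.inclusion hMP m) * c = 1 := by
  set ν : Measure P := Measure.haar
  obtain ⟨B, hBo, hB, -⟩ := exists_compact_open_subgroup (Γ := M) Filter.univ_mem
  obtain ⟨C, hCo, hC, -⟩ := exists_compact_open_subgroup (Γ := N) Filter.univ_mem
  set φ := conjN hMN m
  have hCo' : IsOpen (φ.symm ⁻¹' (C : Set N)) := hCo.preimage φ.symm.continuous
  have hC' : IsCompact (φ.symm ⁻¹' (C : Set N)) :=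
    φ.symm.toHomeomorph.isClosedEmbedding.isCompact_preimage hC
  -- Applied to the set `φ(C)`, whose preimage under `φ` is `C`.
  have h1 := measure_box_conj hMP hNP hdisj hqN ν hq hrec μN φ hc hBo hB hCo'
  have h2 : φ ⁻¹' (φ.symm ⁻¹' (C : Set N)) = C := by
    ext u
    simp
  have hbox : MeasurableSet (box hqN (B : Set M) (C : Set N)) :=
    (isOpen_box hq hqN hBo hCo).measurableSet
  -- Translating by `m` replaces `C` by `φ(C)` and `B` by `B m⁻¹`, and the latter does not change
  -- the volume. With `h1` this shows that the volume of the box equals `c δ(m)` times itself.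
  have h3 : ν.map (· * Subgroup.inclusion hMP m) (box hqN (B : Set M) (C : Set N)) =
      ν (box hqN (B : Set M) (φ.symm ⁻¹' (C : Set N))) := by
    rw [Measure.map_apply (measurable_mul_const _) hbox,
      ← measure_box_mul_right hMP hNP hdisj hqN ν hq μM hC' hBo m]
    congr 1
    ext p
    simp only [box, Set.mem_inter_iff, Set.mem_preimage, (comp_mul_levi hMN hMP hdisj hqN m p).1,
      (comp_mul_levi hMN hMP hdisj hqN m p).2]
    rfl
  rw [Measure.map_right_mul_eq_modularCharacterFun_smul, Measure.smul_apply, ENNReal.smul_def,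
    smul_eq_mul] at h3
  rw [h2, ← h3, ← mul_assoc, eq_comm, ENNReal.mul_eq_right] at h1
  · rw [mul_comm]
    exact_mod_cast h1
  · refine (isOpen_box hq hqN hBo hCo).measure_ne_zero ν ⟨1, ?_⟩
    have := comp_eq (p := 1) (m := 1) (u := 1) hdisj hqN (by simp)
    simp [box, this.1, this.2]
  · exact (isCompact_box hMP hNP hqN hq hB hC).measure_lt_top.ne

end Modulus

/-! ## The groups of rational points over a local field -/

section LocalField

variable (F : Type*) [Field F] [ValuativeRel F] [TopologicalSpace F] [IsNonarchimedeanLocalField F]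

open scoped Valued in
theorem secondCountableTopology_and_totallyDisconnectedSpace_of_localField :
    SecondCountableTopology F ∧ TotallyDisconnectedSpace F := by
  let := IsTopologicalAddGroup.rightUniformSpace F
  have := isUniformAddGroup_of_addCommGroup (G := F)
  -- A rank-one structure makes `F` a normed field; local compactness makes it proper, hence second
  -- countable.
  let : (Valued.v (R := F)).RankOne :=
    { hom' := ValuativeRel.IsRankLeOne.nonempty.some.emb (R := F).comp
        MonoidWithZeroHom.ValueGroup₀.embedding
      strictMono' := ValuativeRel.IsRankLeOne.nonempty.some.strictMono.comp
        MonoidWithZeroHom.ValueGroup₀.embedding_strictMono }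
  have : ProperSpace F := .of_nontriviallyNormedField_of_weaklyLocallyCompactSpace F
  exact ⟨secondCountable_of_proper, inferInstance⟩

variable {F} {n : ℕ}

open ValuativeRel in
/-- The powers of a unipotent matrix are bounded. -/
theorem exists_isCompact_pow_mem {x : Matrix (Fin n) (Fin n) F} (hx : IsNilpotent x) :
    ∃ C : Set (Matrix (Fin n) (Fin n) F), IsCompact C ∧ ∀ m : ℕ, (x + 1) ^ m ∈ C := by
  obtain ⟨r, hr⟩ := hx
  refine ⟨(fun c : ℕ → F => ∑ j ∈ Finset.range r, c j • x ^ j) ''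
    Set.univ.pi fun _ => {a | valuation F a ≤ 1}, ?_, fun m => ⟨fun j => (m.choose j : F), ?_, ?_⟩⟩
  · refine (isCompact_univ_pi fun _ =>
      IsNonarchimedeanLocalField.isCompact_closedBall F 1).image ?_
    fun_prop
  · exact fun j _ => natCast_mem 𝒪[F] (m.choose j)
  · have h1 : (x + 1) ^ m = ∑ j ∈ Finset.range (m + 1 + r), (m.choose j : F) • x ^ j := by
      rw [(Commute.one_right x).add_pow,
        ← Finset.sum_subset (Finset.range_subset_range.2 (Nat.le_add_right (m + 1) r))]
      · refine Finset.sum_congr rfl fun j _ => ?_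
        rw [one_pow, mul_one, Nat.cast_smul_eq_nsmul, nsmul_eq_mul, Nat.cast_comm]
      · intro j _ hj
        rw [Nat.choose_eq_zero_of_lt (by simpa using hj), Nat.cast_zero, zero_smul]
    rw [h1]
    refine Finset.sum_subset (Finset.range_subset_range.2 (Nat.le_add_left r (m + 1))) ?_
    intro j _ hj
    rw [pow_eq_zero_of_le (by simpa using hj) hr, smul_zero]

variable (F n) in
-- The inverse is `det⁻¹ • adjugate`, which is already continuous in the matrix entries.
theorem isInducing_GL_val : IsInducing (Units.val : GL (Fin n) F → Matrix (Fin n) (Fin n) F) := by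
  refine ⟨le_antisymm (continuous_iff_le_induced.1 Units.continuous_val) ?_⟩
  rw [← continuous_id_iff_le]
  refine (@Units.continuous_iff _ _ _ _ (_) _).2 ⟨continuous_induced_dom, ?_⟩
  have h1 : ∀ g : GL (Fin n) F, (g⁻¹).val = g.val.det⁻¹ • g.val.adjugate := fun g => by
    rw [Matrix.coe_units_inv, Matrix.inv_def, Ring.inverse_eq_inv']
  simp only [id, h1]
  let : TopologicalSpace (GL (Fin n) F) := .induced Units.val inferInstance
  have hc : Continuous (Units.val : GL (Fin n) F → Matrix (Fin n) (Fin n) F) :=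
    continuous_induced_dom
  exact (hc.matrix_det.inv₀ fun g => g.isUnit.map Matrix.detMonoidHom |>.ne_zero).smul
    hc.matrix_adjugate

/-- The powers of `g` and of `g⁻¹` stay in compact sets. Along a common convergent subsequence `φ`,
`g ^ φ (k + 1) * g⁻¹ ^ φ k` tends to 1. -/
theorem isRecurrent_of_isNilpotent {g : GL (Fin n) F} (hg : IsNilpotent (g.val - 1)) :
    IsRecurrent g := by
  have := (secondCountableTopology_and_totallyDisconnectedSpace_of_localField F).1
  have := t2Space_of_localField F
  have hsc : SecondCountableTopology (Matrix (Fin n) (Fin n) F) :=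
    inferInstanceAs (SecondCountableTopology (Fin n → Fin n → F))
  -- The inverse is treated separately because a limit of powers of `g` is a priori only a matrix;
  -- the limit for `g⁻¹` supplies its inverse.
  have hg' : IsNilpotent ((g⁻¹).val - 1) := by
    have h : (g⁻¹).val - 1 = -((g⁻¹).val * (g.val - 1)) := by
      rw [mul_sub, ← Units.val_mul, inv_mul_cancel]
      simp
    rw [h]
    refine (Commute.isNilpotent_mul_left ?_ hg).neg
    refine Commute.sub_right ?_ (Commute.one_right _)
    rw [Commute, SemiconjBy, ← Units.val_mul, ← Units.val_mul, inv_mul_cancel, mul_inv_cancel]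
  obtain ⟨C, hC, h⟩ := exists_isCompact_pow_mem hg
  obtain ⟨C', hC', h'⟩ := exists_isCompact_pow_mem hg'
  simp only [sub_add_cancel] at h h'
  obtain ⟨⟨a, b⟩, -, φ, hφ, hlim⟩ := (hC.prod hC').tendsto_subseq
    (x := fun m : ℕ => ((g.val) ^ m, ((g⁻¹).val) ^ m)) fun m => ⟨h m, h' m⟩
  obtain ⟨ha, hb⟩ := Prod.tendsto_iff _ _ |>.1 hlim
  have hab : a * b = 1 := by
    refine tendsto_nhds_unique (ha.mul hb) ?_
    have h1 : ∀ k, g.val ^ φ k * (g⁻¹).val ^ φ k = 1 := fun k => by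
      rw [← Units.val_pow_eq_pow_val, ← Units.val_pow_eq_pow_val, ← Units.val_mul, inv_pow,
        mul_inv_cancel, Units.val_one]
    simp only [Function.comp_apply, h1]
    exact tendsto_const_nhds
  have hd : Filter.Tendsto (fun k => g ^ (φ (k + 1) - φ k)) Filter.atTop (𝓝 1) := by
    rw [(isInducing_GL_val F n).tendsto_nhds_iff, Units.val_one, ← hab]
    refine ((ha.comp (Filter.tendsto_add_atTop_nat 1)).mul hb).congr fun k => ?_
    have h2 : g ^ (φ (k + 1) - φ k) = g ^ φ (k + 1) * g⁻¹ ^ φ k := by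
      rw [inv_pow, pow_sub _ (hφ (Nat.lt_succ_self k)).le]
    simp [h2]
  intro U hU
  obtain ⟨k, hk⟩ := (hd.eventually hU).exists
  exact ⟨_, (Nat.sub_pos_of_lt (hφ (Nat.lt_succ_self k))).ne', hk⟩

theorem IsRecurrent.of_coe {A : Type*} [Group A] [TopologicalSpace A] {H : Subgroup A} {g : H}
    (hg : IsRecurrent (g : A)) : IsRecurrent g := by
  intro U hU
  obtain ⟨W, hW, hWU⟩ := mem_nhds_subtype _ _ _ |>.1 hU
  obtain ⟨k, hk, h⟩ := hg W hW
  exact ⟨k, hk, hWU (by simpa using h)⟩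

variable {G P M N : LinAlgGroup F n}

theorem LinAlgGroup.isClosed_pointsIn (H G : LinAlgGroup F n) :
    IsClosed (H.pointsIn G : Set G.points) :=
  H.isClosed_points.preimage continuous_subtype_val

theorem GL_map_injective :
    Function.Injective (Matrix.GeneralLinearGroup.map (n := Fin n)
      (algebraMap F (AlgebraicClosure F))) :=
  Units.map_injective (Matrix.map_injective (algebraMap F (AlgebraicClosure F)).injective)

theorem LinAlgGroup.IsLevi.isRecurrent (hL : P.IsLevi M N) (u : N.pointsIn G) : IsRecurrent u := by
  refine IsRecurrent.of_coe (IsRecurrent.of_coe (isRecurrent_of_isNilpotent ?_))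
  have h := hL.radical.1.unipotent _ u.2
  have hinj : Function.Injective ((algebraMap F (AlgebraicClosure F)).mapMatrix (m := Fin n)) :=
    Matrix.map_injective (algebraMap F (AlgebraicClosure F)).injective
  rw [← IsNilpotent.map_iff hinj, map_sub, map_one]
  exact h

theorem LinAlgGroup.IsLevi.pointsIn_inf (hL : P.IsLevi M N) :
    M.pointsIn G ⊓ N.pointsIn G = ⊥ := by
  rw [eq_bot_iff]
  intro g hg
  have h : Matrix.GeneralLinearGroup.map (algebraMap F (AlgebraicClosure F)) (g : GL (Fin n) F) ∈
      M.carrier ⊓ N.carrier := ⟨hg.1, hg.2⟩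
  rw [hL.inf, Subgroup.mem_bot] at h
  exact Subtype.ext (GL_map_injective (h.trans (map_one _).symm))

/-- The regular projection has coefficients in `F`, so the Levi component of an `F`-point is an
`F`-point. This gives `P(F) = M(F) N(F)`, with continuity from the polynomial formula. -/
theorem LinAlgGroup.IsLevi.exists_continuous_proj (hL : P.IsLevi M N)
    (hPG : P.carrier ≤ G.carrier) :
    ∃ q : P.pointsIn G → M.pointsIn G, Continuous q ∧
      ∀ p, (q p : G.points)⁻¹ * p ∈ N.pointsIn G := by
  obtain ⟨Q, k, hQ⟩ := hL.proj
  set ι := algebraMap F (AlgebraicClosure F)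
  let A : GL (Fin n) F → Matrix (Fin n) (Fin n) F := fun p => Matrix.of fun i j =>
    (p.val.det ^ k)⁻¹ * MvPolynomial.eval (fun ab : Fin n × Fin n => p.val ab.1 ab.2) (Q i j)
  have hA : Continuous A := by
    refine continuous_matrix fun i j => ?_
    have hent : Continuous fun (g : GL (Fin n) F) (ij : Fin n × Fin n) => g.val ij.1 ij.2 :=
      continuous_pi fun ij => Units.continuous_val.matrix_elem ij.1 ij.2
    exact ((Units.continuous_val.matrix_det.pow k).inv₀ fun g =>
      pow_ne_zero _ (g.isUnit.map Matrix.detMonoidHom).ne_zero).mul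
        ((MvPolynomial.continuous_eval (Q i j)).comp hent)
  have key : ∀ p : P.pointsIn G, ∃ m : M.pointsIn G, (m : GL (Fin n) F).val = A p ∧
      (m : G.points)⁻¹ * p ∈ N.pointsIn G := by
    intro p
    obtain ⟨m, hm, u, hu, hp⟩ := hL.prod _ p.2
    replace hp : Matrix.GeneralLinearGroup.map ι (p : GL (Fin n) F) = m * u := hp
    have hAm : (A p).map ι = m.val := by
      ext i j
      have h := hQ m hm u hu i j
      rw [← hp] at h
      have h1 : MvPolynomial.aeval (fun ab : Fin n × Fin n =>
          (Matrix.GeneralLinearGroup.map ι (p : GL (Fin n) F)).val ab.1 ab.2) (Q i j) =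
          ι (MvPolynomial.eval (fun ab : Fin n × Fin n => (p : GL (Fin n) F).val ab.1 ab.2)
            (Q i j)) :=
        (MvPolynomial.eval₂_comp ι (fun ab : Fin n × Fin n =>
          (p : GL (Fin n) F).val ab.1 ab.2) (Q i j)).symm
      have h2 : (Matrix.GeneralLinearGroup.map ι (p : GL (Fin n) F)).val.det =
          ι (p : GL (Fin n) F).val.det := (RingHom.map_det ι _).symm
      have h3 : ι (p : GL (Fin n) F).val.det ≠ 0 := by
        rw [← h2]
        exact ((Matrix.GeneralLinearGroup.map ι (p : GL (Fin n) F)).isUnit.map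
          Matrix.detMonoidHom).ne_zero
      rw [h1, h2] at h
      change ι (_ * _) = _
      rw [map_mul, h, map_inv₀, map_pow, inv_mul_cancel_left₀ (pow_ne_zero _ h3)]
    have hdet : (A p).det ≠ 0 := by
      intro h0
      have h1 : m.val.det = ι (A p).det := by
        rw [← hAm]
        exact (RingHom.map_det ι _).symm
      rw [h0, map_zero] at h1
      exact (m.isUnit.map Matrix.detMonoidHom).ne_zero h1
    have hm' : Matrix.GeneralLinearGroup.map ι (Matrix.GeneralLinearGroup.mkOfDetNeZero _ hdet) =
        m := Units.ext hAm
    have hmM : Matrix.GeneralLinearGroup.mkOfDetNeZero _ hdet ∈ M.points := by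
      change Matrix.GeneralLinearGroup.map ι _ ∈ M.carrier
      rwa [hm']
    have hmG : Matrix.GeneralLinearGroup.mkOfDetNeZero _ hdet ∈ G.points := hPG (hL.le hmM)
    refine ⟨⟨⟨_, hmG⟩, hmM⟩, rfl, ?_⟩
    change Matrix.GeneralLinearGroup.map ι ((Matrix.GeneralLinearGroup.mkOfDetNeZero _ hdet)⁻¹ *
      (p : GL (Fin n) F)) ∈ N.carrier
    rw [map_mul, map_inv, hm', hp, inv_mul_cancel_left]
    exact hu
  choose q hq hqN using key
  refine ⟨q, ?_, hqN⟩
  rw [IsInducing.subtypeVal.continuous_iff, IsInducing.subtypeVal.continuous_iff,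
    (isInducing_GL_val F n).continuous_iff]
  exact (hA.comp (continuous_subtype_val.comp continuous_subtype_val)).congr fun p => (hq p).symm

instance : T2Space (GL (Fin n) F) := by
  have := t2Space_of_localField F
  infer_instance

instance : SecondCountableTopology (GL (Fin n) F) := by
  have := (secondCountableTopology_and_totallyDisconnectedSpace_of_localField F).1
  have : SecondCountableTopology (Matrix (Fin n) (Fin n) F) :=
    inferInstanceAs (SecondCountableTopology (Fin n → Fin n → F))
  exact (isInducing_GL_val F n).secondCountableTopology

instance : TotallyDisconnectedSpace (GL (Fin n) F) := by
  have := (secondCountableTopology_and_totallyDisconnectedSpace_of_localField F).2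
  have : TotallyDisconnectedSpace (Matrix (Fin n) (Fin n) F) :=
    inferInstanceAs (TotallyDisconnectedSpace (Fin n → Fin n → F))
  exact ⟨isTotallyDisconnected_of_image Units.continuous_val.continuousOn Units.val_injective
    (isTotallyDisconnected_of_totallyDisconnectedSpace _)⟩

end LocalField

end PadicRep

end

theorem mainTheorem2 {F : Type u} [Field F] [ValuativeRel F] [TopologicalSpace F]
    [IsNonarchimedeanLocalField F] {n : ℕ}
    [MeasurableSpace (GL (Fin n) F)] [BorelSpace (GL (Fin n) F)]
    (G P M N : LinAlgGroup F n) (hG : G.IsReductive) (hP : P.IsParabolic G)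
    (hL : P.IsLevi M N)
    (μG : Measure G.points) [μG.IsHaarMeasure] [μG.IsMulRightInvariant]
    (μM : Measure (M.pointsIn G)) [μM.IsHaarMeasure] [μM.IsMulRightInvariant]
    (μN : Measure (N.pointsIn G)) [μN.IsMulRightInvariant] [IsFiniteMeasureOnCompacts μN]
    [μN.IsOpenPosMeasure] :
    -- integration over `N` maps `ℋ(G)` onto `ℋ(N \ G)`
    Function.Surjective (integrateN (N.pointsIn G) μN) ∧
    -- the representation of `M` on `ℋ(N \ G) ⊗ V` is smooth, and it is the one that corresponds to
    -- the left `ℋ(M)`-module structure `φ (ψ ⊗ v) = (φ ψ) ⊗ v`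
    (∀ (V : Type v) [AddCommGroup V] [Module ℂ V] (π : Representation ℂ G.points V), IsSmooth π →
      IsSmooth (tensorRep (hL.pointsIn_normalizes (G := G)) μG π) ∧
      ∀ (φ : TestFn (M.pointsIn G)) (ψ : TestFn (RightCosets (N.pointsIn G))) (v : V),
        heckeAct μM (tensorRep (hL.pointsIn_normalizes (G := G)) μG π) φ
            (HeckeTensor.mk μG (N.pointsIn G) π ψ v) =
          HeckeTensor.mk μG (N.pointsIn G) π
            (leftAct (hL.pointsIn_normalizes (G := G)) μM φ ψ) v) ∧
    -- the natural isomorphism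
    ∃ T : ∀ (V : Type v) [AddCommGroup V] [Module ℂ V] (π : Representation ℂ G.points V),
        IsSmooth π → (HeckeTensor μG (N.pointsIn G) π ≃ₗ[ℂ] Jacquet (N.pointsIn G) π),
      -- it sends `𝒫(f) ⊗ v` to `π(f) v + V(N)`
      (∀ (V : Type v) [AddCommGroup V] [Module ℂ V] (π : Representation ℂ G.points V)
        (hπ : IsSmooth π) (f : TestFn G.points) (v : V),
        T V π hπ (HeckeTensor.mk μG (N.pointsIn G) π (integrateN (N.pointsIn G) μN f) v) =
          (jacquetKer (N.pointsIn G) π).mkQ (heckeAct μG π f v)) ∧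
      -- it is equivariant for `M`, which acts on the source through `δ_P ⊗ (ℋ(N \ G) ⊗ V)`
      (∀ (V : Type v) [AddCommGroup V] [Module ℂ V] (π : Representation ℂ G.points V)
        (hπ : IsSmooth π) (m : M.pointsIn G) (ξ : HeckeTensor μG (N.pointsIn G) π),
        T V π hπ (twist ((modulus (P.pointsIn G)).comp (Subgroup.inclusion hL.pointsIn_le))
            (tensorRep hL.pointsIn_normalizes μG π) m ξ) =
          jacquetRep hL.pointsIn_normalizes π m (T V π hπ ξ)) ∧
      -- it is natural in `V`
      (∀ (V : Type v) [AddCommGroup V] [Module ℂ V] (V' : Type v) [AddCommGroup V'] [Module ℂ V']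
        (π : Representation ℂ G.points V) (π' : Representation ℂ G.points V')
        (hπ : IsSmooth π) (hπ' : IsSmooth π') (A : V →ₗ[ℂ] V')
        (hA : ∀ g v, A (π g v) = π' g (A v))
        (ψ : TestFn (RightCosets (N.pointsIn G))) (v : V),
        T V' π' hπ' (HeckeTensor.mk μG (N.pointsIn G) π' ψ (A v)) =
          jacquetMap (N.pointsIn G) π π' A hA
            (T V π hπ (HeckeTensor.mk μG (N.pointsIn G) π ψ v))) := by 
  have hMN := hL.pointsIn_normalizes (G := G)
  have hN := N.isClosed_pointsIn G
  have hrec : ∀ u : N.pointsIn G, IsRecurrent u := hL.isRecurrent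
  -- The given right Haar measure on `N` is thus two-sided.
  have hleft : μN.IsMulLeftInvariant := isMulLeftInvariant_of_isRecurrent μN hrec
  have hHaar : μN.IsHaarMeasure := {}
  refine ⟨integrateN_surjective μN hN, fun V _ _ π _ => ⟨isSmooth_tensorRep _ μG,
    heckeAct_tensorRep _ μG μM⟩, fun V _ _ π hπ => heckeTensorEquivJacquet μG μN hN hπ,
    fun V _ _ π hπ => heckeTensorEquivJacquet_mk μG μN hN hπ, ?_,
    fun V _ _ V' _ _ π π' hπ hπ' => heckeTensorEquivJacquet_natural μG μN hN hπ hπ'⟩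
  intro V _ _ π hπ m ξ
  obtain ⟨q, hq, hqN⟩ := hL.exists_continuous_proj hP.1
  obtain ⟨c, hc⟩ := exists_map_eq_smul μN (conjN hMN m)
  have hδ := modularCharacterFun_mul_eq_one hMN hL.pointsIn_le
    (fun _ hu => hL.radical.1.le hu) hL.pointsIn_inf hqN hq hrec μM μN hc
  have hint : ∀ f : TestFn (N.pointsIn G),
      ∫ u, f.1 (conjN hMN m u) ∂μN = ((c : ℝ) : ℂ) * ∫ u, f.1 u ∂μN := by
    intro f
    rw [← integral_map (φ := conjN hMN m) (conjN hMN m).continuous.aemeasurable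
      f.continuous.aestronglyMeasurable, hc, integral_smul_nnreal_measure]
    rfl
  change heckeTensorEquivJacquet μG μN hN hπ (modulus (P.pointsIn G)
    (Subgroup.inclusion hL.pointsIn_le m) • tensorRep hMN μG π m ξ) = _
  rw [map_smul, heckeTensorEquivJacquet_tensorRep hMN μG μN hN hπ hint, smul_smul]
  -- The twist by `δ_P` cancels exactly the factor `c` that arises from conjugation on `N`.
  have h1 : modulus (P.pointsIn G) (Subgroup.inclusion hL.pointsIn_le m) * ((c : ℝ) : ℂ) = 1 := by
    change (((Measure.modularCharacterFun _ : ℝ≥0) : ℝ) : ℂ) * ((c : ℝ) : ℂ) = 1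
    rw [← Complex.ofReal_mul, ← NNReal.coe_mul, hδ]
    simp
  rw [h1, one_smul]
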